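/- Assume the Weak Diamond Principle $\Phi$ (recalled below). Let $R$ be an associative ring with unit, let $\mathcal A,\mathcal B$ be classes of (right) $R$-modules such that $(\mathcal A,\mathcal B)$ is a cotorsion pair, and suppose that every module in $\mathcal B$ has injective dimension at most $1$. Then $(\mathcal A,\mathcal B)$ is generated by a set of modules if and only if it is cogenerated by a set of modules. Here, for a class $\mathcal C$ of modules, $\mathcal C^\perp=\{M \mid \mathrm{Ext}^1_R(C,M)=0 \text{ for all } C\in\mathcal C\}$ and ${}^\perp\mathcal C=\{M \mid \mathrm{Ext}^1_R(M,C)=0 \text{ for all } C\in\mathcal C\}$. The pair $(\mathcal A,\mathcal B)$ is a cotorsion pair if $\mathcal A={}^\perp\mathcal B$ and $\mathcal B=\mathcal A^\perp$; it is generated by a set if $\mathcal B=\mathcal S^\perp$ for some set (as opposed to a proper class) $\mathcal S$ of modules, and cogenerated by a set if $\mathcal A={}^\perp\mathcal S$ for some set $\mathcal S$ of modules. For a regular uncountable cardinal $\kappa$, a $\kappa$-filtration of a set $X$ is a family $(X_\alpha)_{\alpha<\kappa}$ of subsets of $X$ with $X=\bigcup_{\alpha<\kappa}X_\alpha$, with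 $|X_\alpha|<\kappa$ and $X_\alpha\subseteq X_{\alpha+1}$ for all $\alpha<\kappa$, and with $X_\alpha=\bigcup_{\beta<\alpha}X_\beta$ for every limit ordinal $\alpha<\kappa$. For a stationary subset $S\subseteq\kappa$, $\Phi_\kappa(S)$ is the following statement: for every set $X$ with $|X|\le\kappa$, every $\kappa$-filtration $(X_\alpha)_{\alpha<\kappa}$ of $X$ and every choice of maps $P_\alpha:\mathcal P(X_\alpha)\to\{0,1\}$ $(\alpha\in S)$, where $\mathcal P$ denotes the power set, there is $\varphi:S\to\{0,1\}$ such that for every $Y\subseteq X$ the set $\{\alpha\in S\mid P_\alpha(Y\cap X_\alpha)=\varphi(\alpha)\}$ is stationary in $\kappa$. The principle $\Phi$ asserts that $\Phi_\kappa(S)$ holds for every regular uncountable cardinal $\kappa$ and every stationary $S\subseteq\kappa$. -/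

import Mathlib

open CategoryTheory Cardinal Set

universe u

/-! ### Cotorsion pairs of modules -/

section Cotorsion

variable {R : Type u} [Ring R]

/-- The class `𝒞^⊥` of all modules `M` with `Ext¹(C, M) = 0` for all `C ∈ 𝒞`. -/
def rightPerp (𝒞 : Set (ModuleCat.{u} R)) : Set (ModuleCat.{u} R) :=
  {M | ∀ C ∈ 𝒞, Subsingleton (Abelian.Ext C M 1)}

/-- The class `^⊥𝒞` of all modules `M` with `Ext¹(M, C) = 0` for all `C ∈ 𝒞`. -/
def leftPerp (𝒞 : Set (ModuleCat.{u} R)) : Set (ModuleCat.{u} R) :=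
  {M | ∀ C ∈ 𝒞, Subsingleton (Abelian.Ext M C 1)}

/-- `(𝒜, ℬ)` is a cotorsion pair: `𝒜 = ^⊥ℬ` and `ℬ = 𝒜^⊥`. -/
structure IsCotorsionPair (𝒜 ℬ : Set (ModuleCat.{u} R)) : Prop where
  left_eq : 𝒜 = leftPerp ℬ
  right_eq : ℬ = rightPerp 𝒜

/-- The pair `(𝒜, ℬ)` is generated by a set: `ℬ = 𝒮^⊥` for some set `𝒮` of modules. Here a set,
as opposed to a proper class, is a `u`-small class of modules of the universe `u`. -/
def IsGeneratedBySet (_𝒜 ℬ : Set (ModuleCat.{u} R)) : Prop :=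
  ∃ 𝒮 : Set (ModuleCat.{u} R), Small.{u} 𝒮 ∧ ℬ = rightPerp 𝒮

/-- The pair `(𝒜, ℬ)` is cogenerated by a set: `𝒜 = ^⊥𝒮` for some set `𝒮` of modules. -/
def IsCogeneratedBySet (𝒜 _ℬ : Set (ModuleCat.{u} R)) : Prop :=
  ∃ 𝒮 : Set (ModuleCat.{u} R), Small.{u} 𝒮 ∧ 𝒜 = leftPerp 𝒮

/-- The class of all modules of injective dimension at most `n`. -/
def injDimLE (R : Type u) [Ring R] (n : ℕ) : Set (ModuleCat.{u} R) :=
  {M | HasInjectiveDimensionLE M n}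

end Cotorsion

/-! ### The Weak Diamond Principle

Ordinals `α < κ` are the elements of the well-ordered type `κ.ord.ToType`. -/

/-- `F` is a `κ`-filtration of the set `X`. -/
structure IsKappaFiltration (κ : Cardinal.{u}) (X : Type u) (F : κ.ord.ToType → Set X) :
    Prop where
  iUnion_eq : ⋃ α, F α = Set.univ
  mk_lt : ∀ α, #(F α) < κ
  subset_succ : ∀ α, F α ⊆ F (Order.succ α)
  eq_of_isSuccLimit : ∀ α, Order.IsSuccLimit α → F α = ⋃ β ∈ Iio α, F β

/-- The statement `Φ_κ(S)`. -/
def WeakDiamondAt (κ : Cardinal.{u}) (S : Set κ.ord.ToType) : Prop :=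
  ∀ (X : Type u) (F : κ.ord.ToType → Set X), #X ≤ κ → IsKappaFiltration κ X F →
    ∀ P : (α : S) → 𝒫 (F α) → Bool,
      ∃ φ : S → Bool, ∀ Y : Set X,
        IsStationary
          {α | ∃ h : α ∈ S, P ⟨α, h⟩ ⟨Y ∩ F α, inter_subset_right⟩ = φ ⟨α, h⟩}

/-- The Weak Diamond Principle `Φ`: `Φ_κ(S)` holds for each regular uncountable cardinal `κ` and
each stationary subset `S` of `κ`. -/
def WeakDiamond : Prop :=
  ∀ κ : Cardinal.{u}, κ.IsRegular → ℵ₀ < κ →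
    ∀ S : Set κ.ord.ToType, IsStationary S → WeakDiamondAt κ S

/-!
The proof rests on two ways to find the members of `leftPerp 𝒩` among the modules `M` of a class
`𝒜 = leftPerp T ⊇ leftPerp 𝒩`, where `T ⊆ 𝒩` is a small family of modules of injective dimension
at most one, by induction on the cardinality of `M`. The bound on the injective dimension makes
`𝒜` closed under submodules, so that the induction hypothesis applies to all smaller submodules of
`M`. By Eklof's lemma (`Orth.of_chain`) it suffices to find a filtration of `M` by such submodules
whose consecutive quotients belong to `𝒜`; being small, these quotients then lie in `leftPerp 𝒩`.

* If `#M` is regular (`mem_leftPerp_of_isRegular`), filter `M` by a continuous chain of smaller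
  submodules `A α`, where `A (α + 1) / A α` is outside of `𝒜` whenever some small quotient
  `A' / A α` is. If the set of `α` at which this happens is not stationary, then a closed cofinal subchain
  is as required. Otherwise, `T` being small, a single `B ∈ T` has `Ext¹(A (α + 1) / A α, B) ≠ 0`
  for stationarily many `α`, and the weak diamond gives `Ext¹(M, B) ≠ 0`
  (`not_orth_of_weakDiamondAt`). There, `M` is a quotient of the free module on its underlying
  set, and a map from the relations to `B` is built so that no function `M → B` splits it. The
  relations in `A (α + 1)` modulo those in `A α` embed in a free module and are orthogonal to `B`
  as well, so that maps can be extended along the chain.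
* If `#M` is singular (`mem_leftPerp_of_isSingular`), Shelah's singular compactness applies. Good
  submodules `A` of a given cardinality, those with `A' / A ∈ 𝒜` for all `A' ≥ A` of the same
  cardinality, exist in abundance (`exists_isGood`), and a matrix of them of size `cof #M × ω` is
  interleaved in the usual way.

In place of the Hill lemma for filtrations, the weaker property `IsHill` is used: there is a
closure operation on `M`, with small values, such that `M / P ∈ leftPerp 𝒩` for each closed
submodule `P`. If `leftPerp 𝒩` is generated by small modules, then all its members have it
(`isHill_of_mem_leftPerp_rightPerp`). To see this, map the relations `K` of a presentation
`M = F / K` to the universal module orthogonal to the generators (`exists_universal_extension`); this map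
extends to `F`, and each value of the extension depends on few elements of `K`.

These steps give `leftPerp T = leftPerp 𝒩` once the two classes agree on the modules up to some
cardinality that bounds `T` (`leftPerp_range_subset`). If the pair is cogenerated by `T`, take `𝒩`
to be `rightPerp 𝒮` for the set `𝒮` of the modules in `𝒜` up to that cardinality: the two classes
agree on small modules by construction, and so `𝒮` generates the pair. If the pair is generated by
a set, take `𝒩 = ℬ`, and let `T` consist of modules of `ℬ` detecting the modules outside of `𝒜`
with fewer than `κ` elements, where `κ` is the supremum of a sequence of cardinals each of which
bounds the modules needed for the previous one; since `κ` is singular, `T` detects the modules of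
cardinality `κ` as well.
-/

/-! ### Vanishing of `Ext¹` as an extension property -/

section Orthogonality

variable {R : Type u} [Ring R]

/-- `Orth R M N` says that `Ext¹(M, N) = 0`, for unbundled modules. -/
def Orth (R : Type u) [Ring R] (M N : Type u) [AddCommGroup M] [Module R M] [AddCommGroup N]
    [Module R N] : Prop :=
  Subsingleton (Abelian.Ext (ModuleCat.of R M) (ModuleCat.of R N) 1)

variable {A B C N : Type u} [AddCommGroup A] [Module R A] [AddCommGroup B] [Module R B]
  [AddCommGroup C] [Module R C] [AddCommGroup N] [Module R N]

theorem mem_leftPerp_iff {𝒞 : Set (ModuleCat.{u} R)} :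
    ModuleCat.of R A ∈ leftPerp 𝒞 ↔ ∀ X ∈ 𝒞, Orth R A X :=
  Iff.rfl

theorem mem_rightPerp_iff {𝒞 : Set (ModuleCat.{u} R)} :
    ModuleCat.of R A ∈ rightPerp 𝒞 ↔ ∀ X ∈ 𝒞, Orth R X A :=
  Iff.rfl

theorem shortExact_of_exact (i : A →ₗ[R] B) (p : B →ₗ[R] C) (hi : Function.Injective i)
    (hp : Function.Surjective p) (hip : Function.Exact i p) :
    (ShortComplex.moduleCatMk i p hip.linearMap_comp_eq_zero).ShortExact :=
  ModuleCat.shortComplex_shortExact _ hip hi hp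

theorem Orth.exists_extend (h : Orth R C N) (i : A →ₗ[R] B) (p : B →ₗ[R] C)
    (hi : Function.Injective i) (hp : Function.Surjective p) (hip : Function.Exact i p)
    (f : A →ₗ[R] N) : ∃ g : B →ₗ[R] N, ∀ a, g (i a) = f a := by
  have hS := shortExact_of_exact i p hi hp hip
  have : Subsingleton (Abelian.Ext (ModuleCat.of R C) (ModuleCat.of R N) 1) := h
  obtain ⟨x, hx⟩ := Abelian.Ext.contravariant_sequence_exact₁ hS (ModuleCat.of R N)
    (Abelian.Ext.mk₀ (ModuleCat.ofHom f)) (n₁ := 1) rfl (this.elim _ _)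
  obtain ⟨g, rfl⟩ := Abelian.Ext.addEquiv₀.symm.surjective x
  refine ⟨g.hom, fun a => ?_⟩
  simp only [Abelian.Ext.addEquiv₀_symm_apply, Abelian.Ext.mk₀_comp_mk₀] at hx
  have h2 := (Abelian.Ext.mk₀_bijective _ _).injective hx
  exact congrArg (fun φ : ModuleCat.of R A ⟶ ModuleCat.of R N => φ.hom a) h2

theorem Orth.of_extend (h : Orth R B N) (i : A →ₗ[R] B) (p : B →ₗ[R] C)
    (hi : Function.Injective i) (hp : Function.Surjective p) (hip : Function.Exact i p)
    (hext : ∀ f : A →ₗ[R] N, ∃ g : B →ₗ[R] N, ∀ a, g (i a) = f a) : Orth R C N := by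
  have hS := shortExact_of_exact i p hi hp hip
  have : Subsingleton (Abelian.Ext (ModuleCat.of R B) (ModuleCat.of R N) 1) := h
  refine subsingleton_of_forall_eq 0 fun x => ?_
  obtain ⟨y, rfl⟩ := Abelian.Ext.contravariant_sequence_exact₃ hS (ModuleCat.of R N) x
    (this.elim _ _) (n₀ := 0) rfl
  obtain ⟨f, rfl⟩ := Abelian.Ext.addEquiv₀.symm.surjective y
  obtain ⟨g, hg⟩ := hext f.hom
  have : f = ModuleCat.ofHom i ≫ ModuleCat.ofHom g := by
    ext a
    exact (hg a).symm
  have h2 : Abelian.Ext.addEquiv₀.symm f = (Abelian.Ext.mk₀ (ModuleCat.ofHom i)).comp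
      (Abelian.Ext.mk₀ (ModuleCat.ofHom g)) (zero_add 0) := by
    rw [Abelian.Ext.mk₀_comp_mk₀, ← this]
    rfl
  exact (congrArg (fun z => hS.extClass.comp z rfl) h2).trans (hS.extClass_comp_assoc _)

theorem Orth.congr (h : Orth R A N) (e : A ≃ₗ[R] B) : Orth R B N := by
  refine h.of_extend (0 : PUnit.{u + 1} →ₗ[R] A) e.toLinearMap (fun _ _ _ => rfl) e.surjective
    (fun a => ?_) fun f => ⟨0, fun a => ?_⟩
  · simp
    exact eq_comm
  · rw [Subsingleton.elim a 0, map_zero, map_zero, map_zero]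

/-- If `N` has injective dimension at most one, then the modules `M` with `Ext¹(M, N) = 0` are
closed under submodules. -/
theorem Orth.of_injective (h : Orth R B N) (hN : HasInjectiveDimensionLE (ModuleCat.of R N) 1)
    (i : A →ₗ[R] B) (hi : Function.Injective i) : Orth R A N := by
  have hS := shortExact_of_exact i (LinearMap.range i).mkQ hi (Submodule.mkQ_surjective _)
    (LinearMap.exact_iff.2 (by simp))
  have : Subsingleton (Abelian.Ext (ModuleCat.of R B) (ModuleCat.of R N) 1) := h
  refine subsingleton_of_forall_eq 0 fun x => ?_
  obtain ⟨y, rfl⟩ := Abelian.Ext.contravariant_sequence_exact₁ hS (ModuleCat.of R N) x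
    (n₁ := 2) rfl (Abelian.Ext.eq_zero_of_hasInjectiveDimensionLT _ 2 le_rfl)
  exact (congrArg (fun z => (Abelian.Ext.mk₀ (ModuleCat.ofHom i)).comp z (zero_add 1))
    (this.elim y 0)).trans (Abelian.Ext.comp_zero _ _ _ _ _)

theorem orth_of_projective [Module.Projective R A] : Orth R A N := by
  have : Projective (ModuleCat.of R A) := inferInstance
  exact subsingleton_of_forall_eq 0 fun x => Abelian.Ext.eq_zero_of_projective x

end Orthogonality

/-! ### Subquotients, chains and the Eklof lemma -/

section Chains

variable {R : Type u} [Ring R] {M N Y : Type u} [AddCommGroup M] [Module R M] [AddCommGroup N]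
  [Module R N] [AddCommGroup Y] [Module R Y]

/-- The quotient `Q / (P ∩ Q)` of two submodules of a module; it is used when `P ≤ Q`. -/
abbrev Quo (P Q : Submodule R M) : Type u := Q ⧸ P.submoduleOf Q

theorem nonempty_quo_equiv_of_surjective {P Q : Submodule R M} (φ : Q →ₗ[R] Y)
    (hφ : Function.Surjective φ) (hP : ∀ x : Q, φ x = 0 ↔ (x : M) ∈ P) :
    Nonempty (Quo P Q ≃ₗ[R] Y) := by
  have : P.submoduleOf Q = LinearMap.ker φ := by
    ext x
    rw [LinearMap.mem_ker, hP]
    rfl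
  exact ⟨(Submodule.quotEquivOfEq _ _ this).trans (φ.quotKerEquivOfSurjective hφ)⟩

theorem Orth.exists_extend_quo {P Q : Submodule R M} (h : Orth R (Quo P Q) N) (hPQ : P ≤ Q)
    (f : P →ₗ[R] N) : ∃ g : Q →ₗ[R] N, ∀ x (hx : x ∈ P), g ⟨x, hPQ hx⟩ = f ⟨x, hx⟩ := by
  obtain ⟨g, hg⟩ := h.exists_extend (Submodule.inclusion hPQ) (P.submoduleOf Q).mkQ
    (Submodule.inclusion_injective hPQ) (Submodule.mkQ_surjective _)
    (LinearMap.exact_iff.2 (by rw [Submodule.ker_mkQ, Submodule.range_inclusion]; rfl)) f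
  exact ⟨g, fun x hx => hg ⟨x, hx⟩⟩

theorem Orth.quo_of_extend {P Q : Submodule R M} (h : Orth R Q N) (hPQ : P ≤ Q)
    (hext : ∀ f : P →ₗ[R] N, ∃ g : Q →ₗ[R] N, ∀ x (hx : x ∈ P), g ⟨x, hPQ hx⟩ = f ⟨x, hx⟩) :
    Orth R (Quo P Q) N :=
  h.of_extend (Submodule.inclusion hPQ) (P.submoduleOf Q).mkQ
    (Submodule.inclusion_injective hPQ) (Submodule.mkQ_surjective _)
    (LinearMap.exact_iff.2 (by rw [Submodule.ker_mkQ, Submodule.range_inclusion]; rfl))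
    fun f => (hext f).imp fun _ hg x => hg x x.2

/-- A compatible family of linear maps on a chain of submodules glues to their union. -/
theorem exists_glue {I : Type*} [LinearOrder I] {K : Submodule R M} {G : I → Submodule R M}
    (hG : Monotone G) (hK : ∀ i, K ≤ G i) (J : Set I) {D : Submodule R M}
    (hD : ∀ x, x ∈ D ↔ x ∈ K ∨ ∃ j ∈ J, x ∈ G j) (c₀ : K →ₗ[R] N) (p : ∀ i, G i →ₗ[R] N)
    (hp₀ : ∀ j ∈ J, ∀ x (hx : x ∈ K), p j ⟨x, hK j hx⟩ = c₀ ⟨x, hx⟩)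
    (hp : ∀ j ∈ J, ∀ i, ∀ hij : i < j, i ∈ J → ∀ x (hx : x ∈ G i),
      p j ⟨x, hG hij.le hx⟩ = p i ⟨x, hx⟩) :
    ∃ f : D →ₗ[R] N, (∀ x (hx : x ∈ K), f ⟨x, (hD x).2 (.inl hx)⟩ = c₀ ⟨x, hx⟩) ∧
      ∀ j (hj : j ∈ J) x (hx : x ∈ G j), f ⟨x, (hD x).2 (.inr ⟨j, hj, hx⟩)⟩ = p j ⟨x, hx⟩ := by
  classical
  have hpp : ∀ i ∈ J, ∀ j ∈ J, ∀ x (hi : x ∈ G i) (hj : x ∈ G j),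
      p i ⟨x, hi⟩ = p j ⟨x, hj⟩ := by
    intro i hiJ j hjJ x hi hj
    rcases lt_trichotomy i j with h | rfl | h
    · exact (hp j hjJ i h hiJ x hi).symm
    · rfl
    · exact hp i hiJ j h hjJ x hj
  let f : D → N := fun x =>
    if hx : (x : M) ∈ K then c₀ ⟨x, hx⟩ else
      p _ ⟨x, (((hD x).1 x.2).resolve_left hx).choose_spec.2⟩
  have f₀ : ∀ x (hx : x ∈ K), f ⟨x, (hD x).2 (.inl hx)⟩ = c₀ ⟨x, hx⟩ := fun x hx => dif_pos hx
  have f₁ : ∀ j (hj : j ∈ J) x (hx : x ∈ G j),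
      f ⟨x, (hD x).2 (.inr ⟨j, hj, hx⟩)⟩ = p j ⟨x, hx⟩ := by
    intro j hj x hx
    by_cases hxK : x ∈ K
    · rw [f₀ x hxK, hp₀ j hj x hxK]
    · simp only [f, dif_neg hxK]
      have h := (((hD x).1 ((hD x).2 (.inr ⟨j, hj, hx⟩))).resolve_left hxK).choose_spec
      exact hpp _ h.1 _ hj x h.2 hx
  have hcase : ∀ x y : D, ((x : M) ∈ K ∧ (y : M) ∈ K) ∨ ∃ j ∈ J, (x : M) ∈ G j ∧ (y : M) ∈ G j := by
    intro x y
    rcases (hD x).1 x.2 with hx | ⟨i, hi, hx⟩ <;> rcases (hD y).1 y.2 with hy | ⟨j, hj, hy⟩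
    · exact .inl ⟨hx, hy⟩
    · exact .inr ⟨j, hj, hK j hx, hy⟩
    · exact .inr ⟨i, hi, hx, hK i hy⟩
    · rcases le_total i j with h | h
      · exact .inr ⟨j, hj, hG h hx, hy⟩
      · exact .inr ⟨i, hi, hx, hG h hy⟩
  refine ⟨⟨⟨f, fun x y => ?_⟩, fun r x => ?_⟩, f₀, f₁⟩
  · rcases hcase x y with ⟨hx, hy⟩ | ⟨j, hj, hx, hy⟩
    · exact (f₀ _ (K.add_mem hx hy)).trans
        ((c₀.map_add ⟨x, hx⟩ ⟨y, hy⟩).trans (by rw [← f₀, ← f₀]))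
    · exact (f₁ j hj _ ((G j).add_mem hx hy)).trans
        (((p j).map_add ⟨x, hx⟩ ⟨y, hy⟩).trans (by rw [← f₁ j hj, ← f₁ j hj]))
  · rcases hcase x x with ⟨hx, -⟩ | ⟨j, hj, hx, -⟩
    · exact (f₀ _ (K.smul_mem r hx)).trans
        ((c₀.map_smul r ⟨x, hx⟩).trans (by rw [← f₀]; rfl))
    · exact (f₁ j hj _ ((G j).smul_mem r hx)).trans
        (((p j).map_smul r ⟨x, hx⟩).trans (by rw [← f₁ j hj]; rfl))

/-- Along a well-ordered chain `G` of submodules containing `K`, a linear map on `K` extends to a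
linear map on the union `T` whose restriction to each `G i` is obtained from its restriction to
`D i = K ∪ ⋃ j < i, G j` by a prescribed extension operator `E i`. -/
theorem exists_linearMap_of_chain {I : Type*} [LinearOrder I] [WellFoundedLT I]
    {K : Submodule R M} {G D : I → Submodule R M} {T : Submodule R M}
    (hG : Monotone G) (hK : ∀ i, K ≤ G i)
    (hD : ∀ i x, x ∈ D i ↔ x ∈ K ∨ ∃ j < i, x ∈ G j) (hT : ∀ x, x ∈ T ↔ x ∈ K ∨ ∃ j, x ∈ G j)
    (c₀ : K →ₗ[R] N) (E : ∀ i, (D i →ₗ[R] N) → (G i →ₗ[R] N))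
    (hE : ∀ i f x (hx : x ∈ D i) (hx' : x ∈ G i), E i f ⟨x, hx'⟩ = f ⟨x, hx⟩) :
    ∃ c : T →ₗ[R] N, (∀ x (hx : x ∈ K), c ⟨x, (hT x).2 (.inl hx)⟩ = c₀ ⟨x, hx⟩) ∧
      ∀ i (hGT : G i ≤ T) (hDT : D i ≤ T),
        c.comp (Submodule.inclusion hGT) = E i (c.comp (Submodule.inclusion hDT)) := by
  classical
  -- `Glues i p f`: the map `f` on `D i` restricts to `c₀` and to the maps `p j` for `j < i`.
  let Glues (i : I) (p : ∀ j < i, G j →ₗ[R] N) (f : D i →ₗ[R] N) : Prop :=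
    (∀ x (hx : x ∈ K), f ⟨x, (hD i x).2 (.inl hx)⟩ = c₀ ⟨x, hx⟩) ∧
      ∀ j (hj : j < i) x (hx : x ∈ G j), f ⟨x, (hD i x).2 (.inr ⟨j, hj, hx⟩)⟩ = p j hj ⟨x, hx⟩
  let step (i : I) (p : ∀ j < i, G j →ₗ[R] N) : G i →ₗ[R] N :=
    E i (if h : ∃ f, Glues i p f then h.choose else 0)
  let P : ∀ i, G i →ₗ[R] N := (wellFounded_lt (α := I)).fix step
  have hP : ∀ i, P i = step i fun j _ => P j := fun i => WellFounded.fix_eq _ _ _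
  have key : ∀ i, ∃ f : D i →ₗ[R] N, Glues i (fun j _ => P j) f ∧ P i = E i f := by
    intro i
    induction i using WellFoundedLT.induction with
    | ind i ih =>
      have hex : ∃ f : D i →ₗ[R] N, Glues i (fun j _ => P j) f := by
        refine exists_glue hG hK (Iio i) (hD i) c₀ P ?_ ?_
        · intro j hj x hx
          obtain ⟨f, hf, hPf⟩ := ih j hj
          rw [hPf, hE j f x ((hD j x).2 (.inl hx)), hf.1]
        · intro j hj k hkj _ x hx
          obtain ⟨f, hf, hPf⟩ := ih j hj
          rw [hPf, hE j f x ((hD j x).2 (.inr ⟨k, hkj, hx⟩)), hf.2 k hkj x hx]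
      refine ⟨hex.choose, hex.choose_spec, ?_⟩
      rw [hP]
      simp only [step, dif_pos hex]
  obtain ⟨c, hc₀, hc⟩ := exists_glue hG hK univ (D := T) (by simpa using hT) c₀ P
    (by
      intro j _ x hx
      obtain ⟨f, hf, hPf⟩ := key j
      rw [hPf, hE j f x ((hD j x).2 (.inl hx)), hf.1])
    (by
      intro j _ k hkj _ x hx
      obtain ⟨f, hf, hPf⟩ := key j
      rw [hPf, hE j f x ((hD j x).2 (.inr ⟨k, hkj, hx⟩)), hf.2 k hkj x hx])
  refine ⟨c, hc₀, fun i hGT hDT => ?_⟩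
  obtain ⟨f, hf, hPf⟩ := key i
  have : c.comp (Submodule.inclusion hDT) = f := by
    ext ⟨x, hx⟩
    rcases (hD i x).1 hx with h | ⟨j, hj, h⟩
    · exact (hc₀ x h).trans (hf.1 x h).symm
    · exact (hc j trivial x h).trans (hf.2 j hj x h).symm
  rw [this, ← hPf]
  ext ⟨x, hx⟩
  exact hc i trivial x hx

theorem exists_extend_of_chain {I : Type*} [LinearOrder I] [WellFoundedLT I]
    {K : Submodule R M} {G D : I → Submodule R M} {T : Submodule R M}
    (hG : Monotone G) (hK : ∀ i, K ≤ G i)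
    (hD : ∀ i x, x ∈ D i ↔ x ∈ K ∨ ∃ j < i, x ∈ G j) (hT : ∀ x, x ∈ T ↔ x ∈ K ∨ ∃ j, x ∈ G j)
    (h : ∀ i, Orth R (Quo (D i) (G i)) N) (c₀ : K →ₗ[R] N) :
    ∃ c : T →ₗ[R] N, ∀ x (hx : x ∈ K), c ⟨x, (hT x).2 (.inl hx)⟩ = c₀ ⟨x, hx⟩ := by
  have hDG : ∀ i, D i ≤ G i := by
    intro i x hx
    rcases (hD i x).1 hx with h | ⟨j, hj, h⟩
    · exact hK i h
    · exact hG hj.le h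
  choose E hE using fun i (f : D i →ₗ[R] N) => (h i).exists_extend_quo (hDG i) f
  obtain ⟨c, hc, -⟩ := exists_linearMap_of_chain hG hK hD hT c₀ E fun i f x hx _ => hE i f x hx
  exact ⟨c, hc⟩

/-- A relative form of Eklof's lemma: `T / K` is orthogonal to `N` if it has a filtration whose
consecutive quotients are, provided that `T` is. -/
theorem Orth.quo_of_chain {I : Type*} [LinearOrder I] [WellFoundedLT I]
    {K : Submodule R M} {G D : I → Submodule R M} {T : Submodule R M}
    (hG : Monotone G) (hK : ∀ i, K ≤ G i)
    (hD : ∀ i x, x ∈ D i ↔ x ∈ K ∨ ∃ j < i, x ∈ G j) (hT : ∀ x, x ∈ T ↔ x ∈ K ∨ ∃ j, x ∈ G j)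
    (h : ∀ i, Orth R (Quo (D i) (G i)) N) (hTN : Orth R T N) : Orth R (Quo K T) N :=
  hTN.quo_of_extend (fun x hx => (hT x).2 (.inl hx)) fun c₀ =>
    exists_extend_of_chain hG hK hD hT h c₀

/-- **Eklof's lemma**: a module with a filtration whose consecutive quotients are orthogonal to
`N` is itself orthogonal to `N`. -/
theorem Orth.of_chain {I : Type*} [LinearOrder I] [WellFoundedLT I]
    {G D : I → Submodule R M} (hG : Monotone G)
    (hD : ∀ i x, x ∈ D i ↔ x = 0 ∨ ∃ j < i, x ∈ G j) (hT : ∀ x, ∃ j, x ∈ G j)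
    (h : ∀ i, Orth R (Quo (D i) (G i)) N) : Orth R M N := by
  -- Pull the filtration back to a free module mapping onto `M`.
  let π : (M →₀ R) →ₗ[R] M := Finsupp.linearCombination R id
  have hπ : Function.Surjective π := Finsupp.linearCombination_id_surjective R M
  refine Orth.of_extend (A := LinearMap.ker π) (B := M →₀ R) orth_of_projective
    (LinearMap.ker π).subtype π Subtype.val_injective hπ
    (LinearMap.exact_subtype_ker_map π) fun f => ?_
  obtain ⟨c, hc⟩ := exists_extend_of_chain (K := LinearMap.ker π) (T := ⊤) (N := N)
    (G := fun i => (G i).comap π) (D := fun i => (D i).comap π)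
    (fun i j hij => Submodule.comap_mono (hG hij))
    (fun i x hx => by
      rw [Submodule.mem_comap, LinearMap.mem_ker.1 hx]
      exact zero_mem _)
    (fun i x => by simp [hD i])
    (fun x => by simpa using Or.inr (hT (π x)))
    (fun i => by
      obtain ⟨e⟩ := nonempty_quo_equiv_of_surjective
        (P := (D i).comap π) (Q := (G i).comap π) (Y := Quo (D i) (G i))
        ((Submodule.mkQ _).comp (π.restrict (p := (G i).comap π) (q := G i) fun x hx => hx))
        (fun y => by
          obtain ⟨⟨y, hy⟩, rfl⟩ := Submodule.mkQ_surjective _ y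
          obtain ⟨x, rfl⟩ := hπ y
          exact ⟨⟨x, hy⟩, rfl⟩)
        (fun x => by
          rw [LinearMap.comp_apply, Submodule.mkQ_apply, Submodule.Quotient.mk_eq_zero]
          rfl)
      exact (h i).congr e.symm) f
  exact ⟨c.comp (LinearMap.id.codRestrict ⊤ fun _ => trivial), fun a => hc a a.2⟩

end Chains

/-! ### Cardinalities of submodules and quotients -/

section Cardinality

universe v

theorem mk_iUnion_le_of_le {ι : Type v} {α : Type u} {μ : Cardinal.{u}} (hμ : ℵ₀ ≤ μ)
    (hι : lift.{u} #ι ≤ lift.{v} μ) {f : ι → Set α} (hf : ∀ i, #(f i) ≤ μ) : #(⋃ i, f i) ≤ μ := by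
  rw [← lift_le.{v}]
  refine (mk_iUnion_le_lift f).trans (mul_le_of_le (by simpa using hμ) hι ?_)
  exact ciSup_le' fun i => lift_le.2 (hf i)

theorem mk_iUnion_le_of_countable {ι : Type v} [Countable ι] {α : Type u} {μ : Cardinal.{u}}
    (hμ : ℵ₀ ≤ μ) {f : ι → Set α} (hf : ∀ i, #(f i) ≤ μ) : #(⋃ i, f i) ≤ μ :=
  mk_iUnion_le_of_le hμ ((lift_le_aleph0.2 mk_le_aleph0).trans (by simpa using hμ)) hf

theorem mk_finsupp_le {α β : Type u} [Zero β] : #(α →₀ β) ≤ max (max #α #β) ℵ₀ := by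
  classical
  refine (mk_le_of_injective (Finsupp.graph_injective α β)).trans ?_
  refine (mk_le_of_injective (f := Finset.toList) fun s t h => ?_).trans
    ((mk_list_le_max _).trans ?_)
  · rw [← Finset.toList_toFinset s, h, Finset.toList_toFinset]
  · rw [mk_prod, lift_id, lift_id]
    exact max_le (le_max_right _ _) (mul_le_max _ _)

variable {R : Type u} [Ring R] {M : Type u} [AddCommGroup M] [Module R M]

theorem mk_span_le {s : Set M} : #(Submodule.span R s) ≤ max (max #s #R) ℵ₀ := by
  refine (mk_le_of_surjective (f := fun x : s →₀ R => (⟨Finsupp.linearCombination R (↑) x, ?_⟩ :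
    Submodule.span R s)) ?_).trans mk_finsupp_le
  · rw [Finsupp.mem_span_iff_linearCombination]
    exact ⟨x, rfl⟩
  · rintro ⟨y, hy⟩
    obtain ⟨x, rfl⟩ := (Finsupp.mem_span_iff_linearCombination R s y).1 hy
    exact ⟨x, rfl⟩

theorem mk_quo_le {P Q : Submodule R M} : #(Quo P Q) ≤ #Q :=
  mk_le_of_surjective (Submodule.mkQ_surjective _)

end Cardinality

/-! ### Universal extensions and the Hill property -/

section UniversalExtension

variable {R : Type u} [Ring R]

/-- The kernel of the canonical map from the free module on the set `M` onto the module `M`. -/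
noncomputable abbrev relations (R : Type u) [Ring R] (M : Type u) [AddCommGroup M] [Module R M] :
    Submodule R (M →₀ R) :=
  LinearMap.ker (Finsupp.linearCombination R (id : M → M))

theorem orth_iff_extend {M N : Type u} [AddCommGroup M] [Module R M] [AddCommGroup N]
    [Module R N] : Orth R M N ↔
      ∀ f : relations R M →ₗ[R] N, ∃ g : (M →₀ R) →ₗ[R] N, ∀ k : relations R M, g k = f k := by
  have hπ := Finsupp.linearCombination_id_surjective R M
  refine ⟨fun h f => ?_, fun h => ?_⟩
  · exact h.exists_extend (A := relations R M) (B := M →₀ R) (relations R M).subtype _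
      Subtype.val_injective hπ (LinearMap.exact_subtype_ker_map _) f
  · exact Orth.of_extend (A := relations R M) (B := M →₀ R) orth_of_projective
      (relations R M).subtype _ Subtype.val_injective hπ (LinearMap.exact_subtype_ker_map _) h

/-- Terms naming elements of the universal module over `K` in which every linear map from a relation
module `L a ≤ (X a →₀ R)` extends to `X a →₀ R`. Besides the elements of `K` there is, for each
family `f` of linear combinations of terms indexed by `L a`, a term for each generator `x : X a`,
naming the value at `x` of the extension of `f`. The family `f` is `k ↦ ∑ i, c k i • t k i`. -/
inductive ExtTerm {ι : Type u} (X : ι → Type u) (L : ∀ a, Submodule R (X a →₀ R)) (K : Type u) :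
    Type u
  | base (k : K) : ExtTerm X L K
  | node (a : ι) (n : L a → ℕ) (c : ∀ k, Fin (n k) → R) (t : ∀ k, Fin (n k) → ExtTerm X L K)
      (x : X a) : ExtTerm X L K

namespace ExtTerm

variable {ι : Type u} {X : ι → Type u} {L : ∀ a, Submodule R (X a →₀ R)} {K : Type u}

/-- The elements of `K` occurring in a term. -/
def support : ExtTerm X L K → Set K
  | base k => {k}
  | node _ _ _ t _ => ⋃ k, ⋃ i, (t k i).support

theorem mk_support_le {μ : Cardinal.{u}} (hμ : ℵ₀ ≤ μ) (hL : ∀ a, #(L a) ≤ μ)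
    (t : ExtTerm X L K) : #t.support ≤ μ := by
  induction t with
  | base k => simpa [support] using one_le_aleph0.trans hμ
  | node a n c t x ih =>
    exact mk_iUnion_le_of_le hμ (by simpa using hL a) fun k => mk_iUnion_le_of_countable hμ (ih k)

variable [AddCommGroup K] [Module R K]

/-- The relations that are to hold among the terms: the inclusion of `K` is linear, and if a family
`f` is linear modulo the relations, then the values at generators define an extension of `f`. -/
structure IsClosed (W : Submodule R (ExtTerm X L K →₀ R)) : Prop where
  base_add : ∀ k l, Finsupp.single (base (k + l)) 1 - Finsupp.single (base k) 1 -
    Finsupp.single (base l) 1 ∈ W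
  base_smul : ∀ (r : R) k, Finsupp.single (base (r • k)) 1 - Finsupp.single (base k) r ∈ W
  node : ∀ a n (c : ∀ k, Fin (n k) → R) t,
    (∀ k l : L a, ∑ i, Finsupp.single (t (k + l) i) (c (k + l) i) -
      ∑ i, Finsupp.single (t k i) (c k i) - ∑ i, Finsupp.single (t l i) (c l i) ∈ W) →
    (∀ (r : R) (k : L a), ∑ i, Finsupp.single (t (r • k) i) (c (r • k) i) -
      r • ∑ i, Finsupp.single (t k i) (c k i) ∈ W) →
    ∀ k : L a, (k : X a →₀ R).mapDomain (node a n c t) - ∑ i, Finsupp.single (t k i) (c k i) ∈ W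

/-- The smallest submodule containing the required relations. -/
noncomputable def rel (X : ι → Type u) (L : ∀ a, Submodule R (X a →₀ R)) (K : Type u)
    [AddCommGroup K] [Module R K] : Submodule R (ExtTerm X L K →₀ R) :=
  sInf {W | IsClosed W}

theorem isClosed_rel : IsClosed (rel X L K) where
  base_add k l := (Submodule.mem_sInf).2 fun _ hW => hW.base_add k l
  base_smul r k := (Submodule.mem_sInf).2 fun _ hW => hW.base_smul r k
  node a n c t h₁ h₂ k := (Submodule.mem_sInf).2 fun _ hW =>
    hW.node a n c t (fun k l => (Submodule.mem_sInf).1 (h₁ k l) _ hW)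
      (fun r k => (Submodule.mem_sInf).1 (h₂ r k) _ hW) k

variable {N : Type u} [AddCommGroup N] [Module R N]

open Classical in
/-- Values at the generators of an extension, chosen among `e`, of a family that is linear; the zero
family is extended by zero. -/
noncomputable def extValue (e : ∀ a, (L a →ₗ[R] N) → ((X a →₀ R) →ₗ[R] N)) (a : ι) (f : L a → N)
    (x : X a) : N :=
  if f = 0 then 0 else if h : ∃ f' : L a →ₗ[R] N, ⇑f' = f then e a h.choose (Finsupp.single x 1)
    else 0

/-- The value of a term in a module with chosen extensions `e`. -/
noncomputable def eval (e : ∀ a, (L a →ₗ[R] N) → ((X a →₀ R) →ₗ[R] N)) (χ : K →ₗ[R] N) :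
    ExtTerm X L K → N
  | base k => χ k
  | node a _ c t x => extValue e a (fun k => ∑ i, c k i • (t k i).eval e χ) x

theorem eval_eq_zero (e : ∀ a, (L a →ₗ[R] N) → ((X a →₀ R) →ₗ[R] N)) (χ : K →ₗ[R] N)
    (t : ExtTerm X L K) (ht : ∀ k ∈ t.support, χ k = 0) : t.eval e χ = 0 := by
  induction t with
  | base k => exact ht k rfl
  | node a n c t x ih =>
    have : (fun k => ∑ i, c k i • (t k i).eval e χ) = 0 := by
      funext k
      refine Finset.sum_eq_zero fun i _ => ?_
      rw [ih k i fun l hl => ht l (mem_iUnion₂.2 ⟨k, i, hl⟩), smul_zero]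
    rw [eval, this, extValue, if_pos rfl]

theorem isClosed_ker_eval (e : ∀ a, (L a →ₗ[R] N) → ((X a →₀ R) →ₗ[R] N))
    (he : ∀ a f (k : L a), e a f k = f k) (χ : K →ₗ[R] N) :
    IsClosed (LinearMap.ker (Finsupp.linearCombination R (eval (X := X) e χ))) where
  base_add k l := by simp [eval]
  base_smul r k := by simp [eval]
  node a n c t h₁ h₂ k := by
    let f : L a →ₗ[R] N :=
      { toFun := fun k => ∑ i, c k i • (t k i).eval e χ
        map_add' := fun k l => by
          have := h₁ k l
          simp only [LinearMap.mem_ker, map_sub, map_sum, Finsupp.linearCombination_single] at this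
          rwa [sub_sub, sub_eq_zero] at this
        map_smul' := fun r k => by
          have := h₂ r k
          simp only [LinearMap.mem_ker, map_sub, map_sum, Finsupp.linearCombination_single,
            map_smul] at this
          rwa [sub_eq_zero] at this }
    have hval : ∃ g : (X a →₀ R) →ₗ[R] N, (∀ k : L a, g k = f k) ∧
        ∀ x, (node a n c t x).eval e χ = g (Finsupp.single x 1) := by
      by_cases hf : ⇑f = 0
      · refine ⟨0, fun k => (congrFun hf k).symm, fun x => ?_⟩
        rw [eval, extValue]
        exact if_pos hf
      · have hex : ∃ f' : L a →ₗ[R] N, ⇑f' = ⇑f := ⟨f, rfl⟩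
        have hch : hex.choose = f := DFunLike.coe_injective hex.choose_spec
        refine ⟨e a f, he a f, fun x => ?_⟩
        rw [eval, extValue]
        exact (if_neg hf).trans ((dif_pos hex).trans (by rw [hch]))
    obtain ⟨g, hgf, hg⟩ := hval
    have hgl : Finsupp.linearCombination R (fun x => (node a n c t x).eval e χ) = g := by
      ext x
      simp [hg]
    rw [LinearMap.mem_ker, map_sub, Finsupp.linearCombination_mapDomain, sub_eq_zero]
    refine (LinearMap.congr_fun hgl k).trans ((hgf k).trans ?_)
    simp [f]

end ExtTerm

open ExtTerm in
/-- Every module `K` maps to a module `B` to which linear maps from the `L a` extend, in such a way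
that linear maps from `K` to modules `N` with the same extension property extend to `B`. Every
element of `B` depends on few elements of `K`: the extension can be taken to vanish
at `b` whenever the given map vanishes on `supp b`. -/
theorem exists_universal_extension {ι : Type u} (X : ι → Type u)
    (L : ∀ a, Submodule R (X a →₀ R)) (K : Type u) [AddCommGroup K] [Module R K]
    {μ : Cardinal.{u}} (hμ : ℵ₀ ≤ μ) (hL : ∀ a, #(L a) ≤ μ) :
    ∃ (B : Type u) (_ : AddCommGroup B) (_ : Module R B) (j : K →ₗ[R] B) (supp : B → Set K),
      (∀ a (f : L a →ₗ[R] B), ∃ g : (X a →₀ R) →ₗ[R] B, ∀ k : L a, g k = f k) ∧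
      (∀ b, #(supp b) ≤ μ) ∧
      ∀ (N : Type u) [AddCommGroup N] [Module R N],
        (∀ a (f : L a →ₗ[R] N), ∃ g : (X a →₀ R) →ₗ[R] N, ∀ k : L a, g k = f k) →
        ∀ χ : K →ₗ[R] N, ∃ v : B →ₗ[R] N, (∀ k, v (j k) = χ k) ∧
          ∀ b, (∀ k ∈ supp b, χ k = 0) → v b = 0 := by
  let q := (rel X L K).mkQ
  have hq : ∀ x, q x = 0 ↔ x ∈ rel X L K := fun x => Submodule.Quotient.mk_eq_zero _
  have hsurj : Function.Surjective q := Submodule.mkQ_surjective _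
  let s := Function.surjInv hsurj
  have hs : ∀ b, q (s b) = b := Function.surjInv_eq hsurj
  let j : K →ₗ[R] (ExtTerm X L K →₀ R) ⧸ rel X L K :=
    { toFun := fun k => q (Finsupp.single (base k) 1)
      map_add' := fun k l => by
        rw [← sub_eq_zero, ← sub_sub, ← map_sub, ← map_sub, hq]
        exact isClosed_rel.base_add k l
      map_smul' := fun r k => by
        rw [← sub_eq_zero, RingHom.id_apply, ← map_smul, ← map_sub, hq]
        simpa using isClosed_rel.base_smul r k }
  refine ⟨_, inferInstance, inferInstance, j,
    fun b => ⋃ t : (s b).support, (t : ExtTerm X L K).support,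
    fun a f => ?_, fun b => ?_, fun N _ _ hN χ => ?_⟩
  · -- Write representatives of the values of `f` as linear combinations of terms.
    have hrep : ∀ y : ExtTerm X L K →₀ R, ∃ (n : ℕ) (c : Fin n → R) (t : Fin n → ExtTerm X L K),
        ∑ i, Finsupp.single (t i) (c i) = y := by
      intro y
      let ε := y.support.equivFin
      refine ⟨_, fun i => y (ε.symm i), fun i => ε.symm i, ?_⟩
      rw [ε.symm.sum_comp fun z : y.support => Finsupp.single (z : ExtTerm X L K) (y z),
        Finset.sum_coe_sort y.support fun z => Finsupp.single z (y z)]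
      exact y.sum_single
    choose n c t h using fun k => hrep (s (f k))
    refine ⟨q.comp (Finsupp.lmapDomain R R (node a n c t)), fun k => ?_⟩
    have hk := isClosed_rel.node a n c t
      (fun k l => by rw [h, h, h, ← hq, map_sub, map_sub, hs, hs, hs, map_add]; abel)
      (fun r k => by rw [h, h, ← hq, map_sub, q.map_smul, f.map_smul, hs, hs, sub_self]) k
    rwa [h, ← hq, map_sub, hs, sub_eq_zero] at hk
  · exact mk_iUnion_le_of_countable hμ fun t => mk_support_le hμ hL _
  · choose e he using hN
    have hle : rel X L K ≤ LinearMap.ker (Finsupp.linearCombination R (ExtTerm.eval e χ)) :=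
      sInf_le (isClosed_ker_eval e he χ)
    refine ⟨(rel X L K).liftQ _ hle, fun k => ?_, fun b hb => ?_⟩
    · exact ((rel X L K).liftQ_apply _ _).trans (by simp [ExtTerm.eval])
    · rw [← hs b]
      refine ((rel X L K).liftQ_apply _ _).trans ?_
      rw [Finsupp.linearCombination_apply]
      refine Finset.sum_eq_zero fun t ht => ?_
      have := eval_eq_zero e χ t fun k hk => hb k (mem_iUnion.2 ⟨⟨t, ht⟩, hk⟩)
      simp only [this, smul_zero]

end UniversalExtension

section Hill

variable {R : Type u} [Ring R]

/-- A module `M` is *`μ`-Hill* with respect to a class `𝒢` of modules if there is a function `d`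
from `M` to subsets of `M` of cardinality at most `μ` such that `M / P` belongs to `𝒢` for each
submodule `P` closed under `d`. -/
def IsHill (μ : Cardinal.{u}) (𝒢 : Set (ModuleCat.{u} R)) (M : Type u) [AddCommGroup M]
    [Module R M] : Prop :=
  ∃ d : M → Set M, (∀ m, #(d m) ≤ μ) ∧
    ∀ P : Submodule R M, (∀ x ∈ P, d x ⊆ P) → ModuleCat.of R (M ⧸ P) ∈ 𝒢

/-- In the cotorsion pair generated by a set of small modules, each module of the left-hand class
is Hill. With `M = F / K` for a free module `F`, let `B` be the universal extension of `K`; the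
inclusion of `K` extends to a map `g : F → B` because `M` lies in the class. If the supports of
the values of `g` at the generators in `P` consist of relations among elements of `P`, then linear
maps from `P` extend to `M`. -/
theorem isHill_of_mem_leftPerp_rightPerp {𝒮 : Set (ModuleCat.{u} R)} [Small.{u} 𝒮]
    {μ : Cardinal.{u}} (hμ : ℵ₀ ≤ μ) (hR : #R ≤ μ) (h𝒮 : ∀ S ∈ 𝒮, #S ≤ μ)
    (M : Type u) [AddCommGroup M] [Module R M]
    (hM : ModuleCat.of R M ∈ leftPerp (rightPerp 𝒮)) :
    IsHill μ (leftPerp (rightPerp 𝒮)) M := by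
  classical
  let S : Shrink.{u} 𝒮 → ModuleCat.{u} R := fun a => (equivShrink 𝒮).symm a
  have hS : ∀ (N : Type u) [AddCommGroup N] [Module R N], ModuleCat.of R N ∈ rightPerp 𝒮 ↔
      ∀ a (f : relations R (S a) →ₗ[R] N),
        ∃ g : (S a →₀ R) →ₗ[R] N, ∀ k : relations R (S a), g k = f k := by
    intro N _ _
    rw [mem_rightPerp_iff]
    refine ⟨fun h a => orth_iff_extend.1 (h (S a) ((equivShrink 𝒮).symm a).2), fun h A hA => ?_⟩
    have hSA : S (equivShrink 𝒮 ⟨A, hA⟩) = A := by simp [S]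
    exact hSA ▸ orth_iff_extend.2 (h (equivShrink 𝒮 ⟨A, hA⟩))
  have hL : ∀ a, #(relations R (S a)) ≤ μ := fun a =>
    (mk_set_le _).trans (mk_finsupp_le.trans
      (max_le (max_le (h𝒮 _ ((equivShrink 𝒮).symm a).2) hR) hμ))
  obtain ⟨B, _, _, j, supp, hB, hsupp, huniv⟩ := exists_universal_extension
    (fun a => S a) (fun a => relations R (S a)) (relations R M) hμ hL
  obtain ⟨g, hg⟩ := orth_iff_extend.1 (hM (ModuleCat.of R B) ((hS B).2 hB)) j
  refine ⟨fun m => ⋃ k : supp (g (Finsupp.single m 1)), ((k : relations R M) : M →₀ R).support,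
    fun m => ?_, fun P hP => ?_⟩
  · exact mk_iUnion_le_of_le hμ (by simpa using hsupp _) fun k => mk_le_aleph0.trans hμ
  · refine mem_leftPerp_iff.2 fun N hN => ?_
    refine Orth.of_extend (A := P) (B := M) (hM N hN) P.subtype P.mkQ Subtype.val_injective
      P.mkQ_surjective (LinearMap.exact_iff.2 (by simp)) fun f => ?_
    let u : (M →₀ R) →ₗ[R] N :=
      Finsupp.linearCombination R fun m => if hm : m ∈ P then f ⟨m, hm⟩ else 0
    have hu : ∀ y : M →₀ R, ↑y.support ⊆ (P : Set M) → ∀ hy : Finsupp.linearCombination R id y ∈ P,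
        u y = f ⟨_, hy⟩ := by
      intro y hyP hy
      have : (⟨_, hy⟩ : P) = ∑ m : y.support, y m • ⟨(m : M), hyP m.2⟩ := by
        ext
        simp only [Submodule.coe_sum, Submodule.coe_smul]
        rw [Finset.sum_coe_sort y.support fun m => y m • m]
        rfl
      rw [this, map_sum, Finsupp.linearCombination_apply, Finsupp.sum, ← Finset.sum_coe_sort]
      refine Finset.sum_congr rfl fun m _ => ?_
      have hm : (m : M) ∈ P := hyP m.2
      rw [map_smul, dif_pos hm]
    obtain ⟨v, hv, hv₀⟩ := huniv N ((hS N).1 hN) (u.comp (relations R M).subtype)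
    -- The map `u - v ∘ g` vanishes on the relations, so it induces a map on `M`.
    have hker : relations R M ≤ LinearMap.ker (u - v.comp g) := by
      intro k hk
      have := hv ⟨k, hk⟩
      rw [← hg] at this
      simpa [sub_eq_zero] using this.symm
    let e := (Finsupp.linearCombination R (id : M → M)).quotKerEquivOfSurjective
      (Finsupp.linearCombination_id_surjective R M)
    refine ⟨((relations R M).liftQ _ hker).comp e.symm.toLinearMap, fun a => ?_⟩
    have hea : e.symm a = (relations R M).mkQ (Finsupp.single (a : M) 1) := by
      rw [LinearEquiv.symm_apply_eq]
      simp [e]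
    rw [LinearMap.comp_apply, Submodule.subtype_apply, LinearEquiv.coe_coe, hea,
      Submodule.mkQ_apply, Submodule.liftQ_apply, LinearMap.sub_apply, LinearMap.comp_apply,
      hv₀ _ fun k hk => ?_, sub_zero]
    · simp [u]
    · have hsub : ↑(k : M →₀ R).support ⊆ (P : Set M) := fun m hm =>
        hP a a.2 (mem_iUnion.2 ⟨⟨k, hk⟩, hm⟩)
      have hk0 := LinearMap.mem_ker.1 k.2
      have h0 := hu k hsub (by rw [hk0]; exact zero_mem P)
      refine h0.trans ?_
      rw [← f.map_zero]
      exact congrArg f (Subtype.ext hk0)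

end Hill

/-! ### Continuous chains of small submodules -/

section RegularChains

variable {R : Type u} [Ring R] {M : Type u} [AddCommGroup M] [Module R M] {κ : Cardinal.{u}}

theorem Cardinal.IsRegular.exists_forall_lt (hκ : κ.IsRegular) {s : Set κ.ord.ToType}
    (hs : #s < κ) : ∃ b, ∀ x ∈ s, x < b := by
  rw [← not_isCofinal_iff]
  intro h
  have := Order.cof_le h
  rw [Ordinal.cof_toType, hκ.cof_ord] at this
  exact this.not_gt hs

theorem mk_Iio_ord_toType_lt (α : κ.ord.ToType) : #(Iio α) < κ :=
  (mk_Iio_lt α (by simp)).trans_eq (by simp)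

theorem mk_sup_lt (hκ : ℵ₀ ≤ κ) {P Q : Submodule R M} (hP : #P < κ) (hQ : #Q < κ) :
    #(P ⊔ Q : Submodule R M) < κ := by
  refine (mk_le_of_surjective (f := fun x : P × Q =>
    (⟨x.1 + x.2, Submodule.add_mem_sup x.1.2 x.2.2⟩ : (P ⊔ Q : Submodule R M))) ?_).trans_lt ?_
  · rintro ⟨x, hx⟩
    obtain ⟨y, hy, z, hz, rfl⟩ := Submodule.mem_sup.1 hx
    exact ⟨(⟨y, hy⟩, ⟨z, hz⟩), rfl⟩
  · simpa using mul_lt_of_lt hκ hP hQ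

theorem mk_iSup_lt (hκ : κ.IsRegular) (hκ₀ : ℵ₀ < κ) (hR : #R < κ) {ι : Type u} (hι : #ι < κ)
    {f : ι → Submodule R M} (hf : ∀ i, #(f i) < κ) : #(⨆ i, f i : Submodule R M) < κ := by
  rw [Submodule.iSup_eq_span]
  exact mk_span_le.trans_lt (max_lt (max_lt
    ((card_iUnion_lt_iff_forall_of_isRegular hκ hι).2 hf) hR) hκ₀)

/-- A continuous chain of small submodules, indexed by a regular cardinal, that is built by
iterating a given operation. -/
theorem exists_continuous_chain (hκ : κ.IsRegular) (hκ₀ : ℵ₀ < κ) (hR : #R < κ)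
    (nxt : κ.ord.ToType → Submodule R M → Submodule R M)
    (hnxt : ∀ α (P : Submodule R M), #P < κ → #(nxt α P) < κ) :
    ∃ A : κ.ord.ToType → Submodule R M, Monotone A ∧ (∀ α, #(A α) < κ) ∧
      (∀ β α, β < α → nxt β (A β) ≤ A α) ∧
      ∀ α, Order.IsSuccLimit α → ∀ x ∈ A α, ∃ β < α, x ∈ A β := by
  let A : κ.ord.ToType → Submodule R M :=
    (wellFounded_lt (α := κ.ord.ToType)).fix fun α rec => ⨆ β : Iio α, nxt β (rec β β.2)
  have hA : ∀ α, A α = ⨆ β : Iio α, nxt β (A β) := fun α => WellFounded.fix_eq _ _ _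
  have hmono : Monotone A := by
    intro α β hαβ
    rw [hA, hA β]
    exact iSup_le fun γ => le_iSup (fun γ : Iio β => nxt γ (A γ)) ⟨γ, lt_of_lt_of_le γ.2 hαβ⟩
  have hstep : ∀ β α, β < α → nxt β (A β) ≤ A α := by
    intro β α h
    rw [hA α]
    exact le_iSup (fun γ : Iio α => nxt γ (A γ)) ⟨β, h⟩
  refine ⟨A, hmono, fun α => ?_, hstep, fun α hα x hx => ?_⟩
  · induction α using WellFoundedLT.induction with
    | ind α ih =>
      rw [hA]
      exact mk_iSup_lt hκ hκ₀ hR (mk_Iio_ord_toType_lt α) fun β => hnxt _ _ (ih β β.2)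
  · have hne : Nonempty (Iio α) := by
      obtain ⟨b, hb⟩ := not_isMin_iff.1 hα.1
      exact ⟨⟨b, hb⟩⟩
    have hle : A α ≤ ⨆ β : Iio α, A β := by
      rw [hA]
      refine iSup_le fun β => ?_
      have hlt : Order.succ (β : κ.ord.ToType) < α := hα.succ_lt β.2
      refine le_trans (hstep _ _ (Order.lt_succ_of_not_isMax fun hmax => ?_))
        (le_iSup (fun β : Iio α => A β) ⟨_, hlt⟩)
      exact hmax.not_lt β.2
    obtain ⟨β, hβ⟩ := (Submodule.mem_iSup_of_directed (fun β : Iio α => A β)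
      (directed_of_isDirected_le fun β γ h => hmono h)).1 (hle hx)
    exact ⟨β, β.2, hβ⟩

/-- Some members of a continuous chain are closed under a given set-valued operation. -/
theorem exists_closed_of_chain (hκ : κ.IsRegular) (hκ₀ : ℵ₀ < κ)
    {A : κ.ord.ToType → Submodule R M} (hmono : Monotone A) (hA : ∀ α, #(A α) < κ)
    (hlim : ∀ α, Order.IsSuccLimit α → ∀ x ∈ A α, ∃ β < α, x ∈ A β)
    (d : M → Set M) (hd : ∀ x, #(d x) < κ) (hdA : ∀ x, ∀ y ∈ d x, ∃ α, y ∈ A α)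
    (α₀ : κ.ord.ToType) : ∃ α, α₀ < α ∧ ∀ x ∈ A α, d x ⊆ A α := by
  have hb : ∀ α, ∃ β, α < β ∧ ∀ x ∈ A α, d x ⊆ A β := by
    intro α
    choose i hi using hdA
    let s : Set κ.ord.ToType := ⋃ x : A α, range fun y : d x => i x y y.2
    obtain ⟨β, hβ⟩ := hκ.exists_forall_lt (s := s)
      ((card_iUnion_lt_iff_forall_of_isRegular hκ (hA α)).2 fun x =>
        mk_range_le.trans_lt (hd x))
    have := noMaxOrder hκ.aleph0_le
    obtain ⟨γ, hγ⟩ := exists_gt (max α β)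
    refine ⟨γ, (le_max_left _ _).trans_lt hγ, fun x hx y hy => ?_⟩
    exact hmono (((hβ _ (mem_iUnion.2 ⟨⟨x, hx⟩, ⟨⟨y, hy⟩, rfl⟩⟩)).le.trans
      (le_max_right _ _)).trans hγ.le) (hi x y hy)
  choose b hb hbd using hb
  let a : ℕ → κ.ord.ToType := fun n => b^[n] α₀
  have ha : ∀ n, a (n + 1) = b (a n) := fun n => Function.iterate_succ_apply' b n α₀
  obtain ⟨γ, hγ⟩ := hκ.exists_forall_lt (s := range a)
    (((countable_range a).le_aleph0).trans_lt hκ₀)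
  -- The supremum of the sequence `a` is a limit, so it is closed.
  obtain ⟨α, hα, hmin⟩ := (wellFounded_lt (α := κ.ord.ToType)).has_min
    {γ | ∀ n, a n < γ} ⟨γ, fun n => hγ _ ⟨n, rfl⟩⟩
  have hex : ∀ β < α, ∃ n, β ≤ a n := by
    intro β hβ
    by_contra! h
    exact hmin β h hβ
  have hαlim : Order.IsSuccLimit α := by
    refine ⟨fun h => h.not_lt (hα 0), fun β hβ => ?_⟩
    obtain ⟨n, hn⟩ := hex β hβ.lt
    exact hβ.2 (hn.trans_lt ((hb (a n)).trans_eq (ha n).symm)) (hα (n + 1))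
  refine ⟨α, hα 0, fun x hx => ?_⟩
  obtain ⟨β, hβ, hxβ⟩ := hlim α hαlim x hx
  obtain ⟨n, hn⟩ := hex β hβ
  refine (hbd (a n) x (hmono hn hxβ)).trans ?_
  rw [← ha]
  exact hmono (hα (n + 1)).le

end RegularChains

/-! ### Classes closed under submodules -/

section Classes

variable {R : Type u} [Ring R] {M : Type u} [AddCommGroup M] [Module R M]

/-- The class `𝒜` of modules is closed under submodules (and isomorphic copies). -/
def IsSubmoduleClosed (𝒜 : Set (ModuleCat.{u} R)) : Prop :=
  ∀ ⦃A B : Type u⦄ [AddCommGroup A] [Module R A] [AddCommGroup B] [Module R B] (i : A →ₗ[R] B),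
    Function.Injective i → ModuleCat.of R B ∈ 𝒜 → ModuleCat.of R A ∈ 𝒜

theorem isSubmoduleClosed_leftPerp {𝒯 : Set (ModuleCat.{u} R)} (h : 𝒯 ⊆ injDimLE R 1) :
    IsSubmoduleClosed (leftPerp 𝒯) :=
  fun _ _ _ _ _ _ i hi hB N hN => Orth.of_injective (hB N hN) (h hN) i hi

theorem quo_mem_of_le {𝒜 : Set (ModuleCat.{u} R)} (h𝒜 : IsSubmoduleClosed 𝒜)
    {P Q Q' : Submodule R M} (hQ : Q ≤ Q') (h : ModuleCat.of R (Quo P Q') ∈ 𝒜) :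
    ModuleCat.of R (Quo P Q) ∈ 𝒜 :=
  h𝒜 (Submodule.mapQ (P.submoduleOf Q) (P.submoduleOf Q') (Submodule.inclusion hQ) fun _ hx => hx)
    (LinearMap.ker_eq_bot.1 (Submodule.ker_liftQ_eq_bot _ _ _ fun _ hx =>
      (Submodule.Quotient.mk_eq_zero (P.submoduleOf Q')).1 hx)) h

theorem quo_bot_mem {𝒜 : Set (ModuleCat.{u} R)} (h𝒜 : IsSubmoduleClosed 𝒜)
    (hM : ModuleCat.of R M ∈ 𝒜) {P Q : Submodule R M} (hP : P = ⊥) :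
    ModuleCat.of R (Quo P Q) ∈ 𝒜 := by
  obtain ⟨e⟩ := nonempty_quo_equiv_of_surjective (P := P) (Q := Q) LinearMap.id
    Function.surjective_id (by simp [hP])
  exact h𝒜 (Q.subtype.comp e.toLinearMap) (Subtype.val_injective.comp e.injective) hM

theorem mem_leftPerp_congr {𝒩 : Set (ModuleCat.{u} R)} {A B : Type u} [AddCommGroup A] [Module R A]
    [AddCommGroup B] [Module R B] (e : A ≃ₗ[R] B) (h : ModuleCat.of R A ∈ leftPerp 𝒩) :
    ModuleCat.of R B ∈ leftPerp 𝒩 :=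
  fun N hN => Orth.congr (h N hN) e

/-- The union of the members of a chain of submodules with index less than `i`. -/
theorem exists_union_lt {I : Type*} [LinearOrder I] {G : I → Submodule R M} (hG : Monotone G)
    (i : I) : ∃ D : Submodule R M, ∀ x, x ∈ D ↔ x = 0 ∨ ∃ j < i, x ∈ G j := by
  refine ⟨⨆ j : Iio i, G j, fun x => ?_⟩
  rcases isEmpty_or_nonempty (Iio i) with h | h
  · have : ∀ j, ¬ j < i := fun j hj => h.elim ⟨j, hj⟩
    simp [iSup_of_empty, this]
  · rw [Submodule.mem_iSup_of_directed (fun j : Iio i => G j)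
      (directed_of_isDirected_le fun _ _ h => hG h)]
    constructor
    · rintro ⟨j, hj⟩
      exact .inr ⟨j, j.2, hj⟩
    · rintro (rfl | ⟨j, hj, hx⟩)
      · exact ⟨h.some, zero_mem _⟩
      · exact ⟨⟨j, hj⟩, hx⟩

end Classes

section Good

variable {R : Type u} [Ring R] {M : Type u} [AddCommGroup M] [Module R M]

/-- A submodule `A` of cardinality at most `ν` is `ν`-good if `A' / A` lies in `𝒜` for every
submodule `A'` of cardinality at most `ν` containing `A`. -/
def IsGood (ν : Cardinal.{u}) (𝒜 : Set (ModuleCat.{u} R)) (A : Submodule R M) : Prop :=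
  #A ≤ ν ∧ ∀ A', A ≤ A' → #A' ≤ ν → ModuleCat.of R (Quo A A') ∈ 𝒜

/-- If the submodules of cardinality at most `ν⁺` are Hill, then small subsets are contained in good
submodules: otherwise one could build a chain of length `ν⁺` with all consecutive quotients
outside of `𝒜`, contradicting the Hill property of its union. -/
theorem exists_isGood {ν : Cardinal.{u}} (hν : ℵ₀ ≤ ν) (hR : #R ≤ ν) {𝒜 : Set (ModuleCat.{u} R)}
    (h𝒜 : IsSubmoduleClosed 𝒜)
    (hHill : ∀ U : Submodule R M, #U ≤ Order.succ ν → IsHill ν 𝒜 U) (X : Set M) (hX : #X ≤ ν) :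
    ∃ A : Submodule R M, X ⊆ A ∧ IsGood ν 𝒜 A := by
  classical
  by_contra! hbad
  have hbad' : ∀ A : Submodule R M, X ⊆ A → #A ≤ ν →
      ∃ A', A ≤ A' ∧ #A' ≤ ν ∧ ModuleCat.of R (Quo A A') ∉ 𝒜 := by
    intro A hXA hA
    have := hbad A hXA
    simp only [IsGood, not_and, not_forall] at this
    obtain ⟨A', h₁, h₂, h₃⟩ := this hA
    exact ⟨A', h₁, h₂, h₃⟩
  choose nx hnx₁ hnx₂ hnx₃ using hbad'
  have hκ := isRegular_succ hν
  have hκ₀ : ℵ₀ < Order.succ ν := Order.lt_succ_iff.2 hν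
  have hspan : #(Submodule.span R X) ≤ ν := mk_span_le.trans (max_le (max_le hX hR) hν)
  let nxt : Submodule R M → Submodule R M := fun P =>
    if h : X ⊆ P ∧ #P ≤ ν then nx P h.1 h.2 else Submodule.span R X ⊔ P
  obtain ⟨A, hmono, hA, hstep, hlim⟩ := exists_continuous_chain (M := M) hκ hκ₀
    (Order.lt_succ_iff.2 hR) (fun _ => nxt) (by
      intro α P hP
      by_cases h : X ⊆ P ∧ #P ≤ ν
      · simp only [nxt, dif_pos h]
        exact Order.lt_succ_iff.2 (hnx₂ P h.1 h.2)
      · simp only [nxt, dif_neg h]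
        exact mk_sup_lt hκ₀.le (Order.lt_succ_iff.2 hspan) hP)
  have hXn : ∀ P : Submodule R M, X ⊆ nxt P := by
    intro P
    by_cases h : X ⊆ P ∧ #P ≤ ν
    · simp only [nxt, dif_pos h]
      exact h.1.trans (hnx₁ P h.1 h.2)
    · simp only [nxt, dif_neg h]
      exact Submodule.subset_span.trans (le_sup_left (a := Submodule.span R X) (b := P))
  have hnomax := noMaxOrder hκ.aleph0_le
  have hne : Nonempty (Order.succ ν).ord.ToType := by
    rw [← mk_ne_zero_iff, mk_toType, card_ord]
    exact hκ.pos.ne'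
  have hU : ∀ x, x ∈ (⨆ α, A α : Submodule R M) ↔ ∃ α, x ∈ A α := fun x =>
    Submodule.mem_iSup_of_directed A (directed_of_isDirected_le hmono)
  obtain ⟨d, hd, hdP⟩ := hHill (⨆ α, A α) (by
    have : ((⨆ α, A α : Submodule R M) : Set M) = ⋃ α, (A α : Set M) := by
      ext x
      simpa using hU x
    change #((⨆ α, A α : Submodule R M) : Set M) ≤ _
    rw [this]
    exact mk_iUnion_le_of_le hκ₀.le (by simp) fun α => (hA α).le)
  let d' : M → Set M := fun x =>
    if hx : x ∈ (⨆ α, A α : Submodule R M) then Subtype.val '' d ⟨x, hx⟩ else ∅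
  obtain ⟨α, hα, hcl⟩ := exists_closed_of_chain hκ hκ₀ hmono hA hlim d'
    (by
      intro x
      by_cases hx : x ∈ (⨆ α, A α : Submodule R M)
      · simp only [d', dif_pos hx]
        exact mk_image_le.trans_lt (Order.lt_succ_iff.2 (hd _))
      · simp only [d', dif_neg hx]
        simp)
    (by
      intro x y hy
      by_cases hx : x ∈ (⨆ α, A α : Submodule R M)
      · simp only [d', dif_pos hx] at hy
        obtain ⟨z, -, rfl⟩ := hy
        exact (hU z).1 z.2
      · simp [d', dif_neg hx] at hy) hne.some
  have hXA : X ⊆ A α := (hXn _).trans (hstep _ _ hα)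
  have hAα := Order.lt_succ_iff.1 (hA α)
  refine hnx₃ (A α) hXA hAα ?_
  have hnx : nx (A α) hXA hAα = nxt (A α) := by
    simp only [nxt, dif_pos (show X ⊆ A α ∧ #(A α) ≤ ν from ⟨hXA, hAα⟩)]
  rw [hnx]
  obtain ⟨β, hβ⟩ := exists_gt α
  refine quo_mem_of_le h𝒜 ((hstep α β hβ).trans (le_iSup A β)) (hdP _ fun x hx y hy => ?_)
  refine hcl (x : M) hx ?_
  simp only [d', dif_pos x.2]
  exact ⟨y, hy, rfl⟩

/-- A Hill operation on a quotient `Q / P` gives an operation on the ambient module: if `S` is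
closed under it, then `(Q + S) / (P + S)` lies in the class. -/
theorem IsHill.exists_relative {μ : Cardinal.{u}} {𝒩 : Set (ModuleCat.{u} R)} {P Q : Submodule R M}
    (hPQ : P ≤ Q) (h : IsHill μ (leftPerp 𝒩) (Quo P Q)) :
    ∃ e : M → Set M, (∀ x, #(e x) ≤ μ) ∧ ∀ S : Submodule R M, (∀ x ∈ S, e x ⊆ S) →
      ModuleCat.of R (Quo (P ⊔ S) (Q ⊔ S)) ∈ leftPerp 𝒩 := by
  classical
  obtain ⟨d, hd, hdP⟩ := h
  have hsurj : Function.Surjective (P.submoduleOf Q).mkQ := Submodule.mkQ_surjective _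
  let s := Function.surjInv hsurj
  have hs : ∀ z, (P.submoduleOf Q).mkQ (s z) = z := Function.surjInv_eq hsurj
  refine ⟨fun x => if hx : x ∈ Q then
      (fun z => (s z : M)) '' d ((P.submoduleOf Q).mkQ ⟨x, hx⟩) else ∅, fun x => ?_, fun S hS => ?_⟩
  · by_cases hx : x ∈ Q
    · simp only [dif_pos hx]
      exact mk_image_le.trans (hd _)
    · simp [dif_neg hx]
  · let φ : Quo P Q →ₗ[R] Quo (P ⊔ S) (Q ⊔ S) :=
      Submodule.mapQ _ _ (Submodule.inclusion le_sup_left) fun x hx => le_sup_left (b := S) hx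
    have hφ : ∀ x : Q, φ ((P.submoduleOf Q).mkQ x) = 0 ↔ (x : M) ∈ P ⊔ S :=
      fun x => Submodule.Quotient.mk_eq_zero ((P ⊔ S).submoduleOf (Q ⊔ S))
    have hφs : Function.Surjective φ := by
      intro z
      obtain ⟨⟨z, hz⟩, rfl⟩ := Submodule.mkQ_surjective _ z
      obtain ⟨q, hq, y, hy, rfl⟩ := Submodule.mem_sup.1 hz
      refine ⟨(P.submoduleOf Q).mkQ ⟨q, hq⟩,
        (Submodule.Quotient.eq ((P ⊔ S).submoduleOf (Q ⊔ S))).2 ?_⟩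
      change q - (q + y) ∈ P ⊔ S
      rw [sub_add_cancel_left]
      exact neg_mem (Submodule.mem_sup_right hy)
    refine mem_leftPerp_congr (φ.quotKerEquivOfSurjective hφs) (hdP _ fun z hz w hw => ?_)
    -- A class in the kernel of `φ` has a representative in `S`, to which the closure applies.
    obtain ⟨⟨x, hx⟩, rfl⟩ := hsurj z
    obtain ⟨p, hp, y, hy, hpy⟩ := Submodule.mem_sup.1 ((hφ ⟨x, hx⟩).1 hz)
    have hyQ : y ∈ Q := by
      have := Q.sub_mem hx (hPQ hp)
      rwa [← show p + y = x from hpy, add_sub_cancel_left] at this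
    have hxy : (P.submoduleOf Q).mkQ ⟨x, hx⟩ = (P.submoduleOf Q).mkQ ⟨y, hyQ⟩ := by
      rw [Submodule.mkQ_apply, Submodule.mkQ_apply, Submodule.Quotient.eq]
      change x - y ∈ P
      rwa [← show p + y = x from hpy, add_sub_cancel_right]
    rw [hxy] at hw
    have hwS : (s w : M) ∈ S := by
      refine hS y hy ?_
      simp only [dif_pos hyQ]
      exact ⟨w, hw, rfl⟩
    have := (hφ (s w)).2 (Submodule.mem_sup_right hwS)
    rwa [hs] at this

end Good

/-! ### Singular compactness -/

section Singular

variable {R : Type u} [Ring R] {M : Type u} [AddCommGroup M] [Module R M]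

theorem IsHill.mono {μ ν : Cardinal.{u}} {𝒢 ℋ : Set (ModuleCat.{u} R)} (h : IsHill μ 𝒢 M)
    (hμν : μ ≤ ν) (h𝒢 : 𝒢 ⊆ ℋ) : IsHill ν ℋ M := by
  obtain ⟨d, hd, hP⟩ := h
  exact ⟨d, fun m => (hd m).trans hμν, fun P h => h𝒢 (hP P h)⟩

/-- A set of singular cardinality is covered by a chain of smaller subsets, shorter
than each of a chain of cardinal bounds on the sizes of these subsets. -/
theorem exists_cover_of_isSingular {α : Type u} (hα : (#α).IsSingular) {μ : Cardinal.{u}}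
    (hμ : μ < #α) : ∃ (I : Type u) (_ : LinearOrder I) (_ : WellFoundedLT I) (ℓ : I → Cardinal.{u})
      (X : I → Set α), Monotone ℓ ∧ (∀ i, μ ≤ ℓ i) ∧ (∀ i, #I ≤ ℓ i) ∧ (∀ i, ℓ i < #α) ∧
      (∀ i, #(X i) ≤ ℓ i) ∧ ∀ x, ∃ i, x ∈ X i := by
  have h₀ : ℵ₀ ≤ #α := hα.aleph0_le
  obtain ⟨C, hC, hcard⟩ := Order.exists_cof_eq (α := (#α).ord.ToType)
  rw [Ordinal.cof_toType] at hcard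
  have hClt : #C < #α := hcard.trans_lt hα.cof_ord_lt
  have hIic : ∀ i : (#α).ord.ToType, #(Iic i) < #α := by
    intro i
    have := noMaxOrder h₀
    obtain ⟨j, hj⟩ := exists_gt i
    exact (mk_le_mk_of_subset (Iic_subset_Iio.2 hj)).trans_lt (mk_Iio_ord_toType_lt j)
  obtain ⟨f⟩ := Cardinal.eq.1 (show #(#α).ord.ToType = #α by simp)
  refine ⟨C, inferInstance, inferInstance, fun i => max (max #(Iic i.1) μ) #C,
    fun i => f '' Iic i.1, fun i j h => ?_, fun i => ?_, fun i => le_max_right _ _, fun i => ?_,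
    fun i => ?_, fun x => ?_⟩
  · exact max_le_max (max_le_max (mk_le_mk_of_subset (Iic_subset_Iic.2 h)) le_rfl) le_rfl
  · exact (le_max_right _ _).trans (le_max_left _ _)
  · exact max_lt (max_lt (hIic _) hμ) hClt
  · exact mk_image_le.trans ((le_max_left _ _).trans (le_max_left _ _))
  · obtain ⟨c, hc, hle⟩ := hC (f.symm x)
    exact ⟨⟨c, hc⟩, f.symm x, hle, f.apply_symm_apply x⟩

/-- **Singular compactness.** Let the class `𝒜` be closed under submodules and contain
`leftPerp 𝒩`, and let all members of `leftPerp 𝒩` be Hill. If `M ∈ 𝒜` has singular cardinality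
and all smaller members of `𝒜` lie in `leftPerp 𝒩`, then so does `M`. -/
theorem mem_leftPerp_of_isSingular {μ : Cardinal.{u}} (hμ : ℵ₀ ≤ μ) (hR : #R ≤ μ)
    {𝒜 𝒩 : Set (ModuleCat.{u} R)} (h𝒜 : IsSubmoduleClosed 𝒜) (h𝒩 : leftPerp 𝒩 ⊆ 𝒜)
    (hHill : ∀ (X : Type u) [AddCommGroup X] [Module R X], ModuleCat.of R X ∈ leftPerp 𝒩 →
      IsHill μ (leftPerp 𝒩) X)
    (hM : ModuleCat.of R M ∈ 𝒜) (hsing : (#M).IsSingular) (hμM : μ < #M)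
    (ih : ∀ (X : Type u) [AddCommGroup X] [Module R X], ModuleCat.of R X ∈ 𝒜 → #X < #M →
      ModuleCat.of R X ∈ leftPerp 𝒩) :
    ModuleCat.of R M ∈ leftPerp 𝒩 := by
  classical
  obtain ⟨I, _, _, ℓ, X, hℓ, hμℓ, hIℓ, hℓM, hXℓ, hX⟩ := exists_cover_of_isSingular hsing hμM
  have hℵℓ : ∀ i, ℵ₀ ≤ ℓ i := fun i => hμ.trans (hμℓ i)
  have hsub : ∀ A : Submodule R M, ModuleCat.of R A ∈ 𝒜 := fun A =>
    h𝒜 A.subtype Subtype.val_injective hM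
  have hsmall : ∀ P Q : Submodule R M, #Q < #M → ModuleCat.of R (Quo P Q) ∈ 𝒜 →
      ModuleCat.of R (Quo P Q) ∈ leftPerp 𝒩 := fun P Q hQ h => ih _ h (mk_quo_le.trans_lt hQ)
  have hgood : ∀ i (Y : Set M), ∃ A : Submodule R M, #Y ≤ ℓ i → Y ⊆ A ∧ IsGood (ℓ i) 𝒜 A := by
    intro i Y
    by_cases hY : #Y ≤ ℓ i
    · obtain ⟨A, hA⟩ := exists_isGood (hℵℓ i) (hR.trans (hμℓ i)) h𝒜 (fun U hU =>
        (hHill U (ih U (hsub U) (hU.trans_lt (hsing.isSuccLimit.succ_lt (hℓM i))))).mono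
          (hμℓ i) h𝒩) Y hY
      exact ⟨A, fun _ => hA⟩
    · exact ⟨⊥, fun h => absurd h hY⟩
  choose g hg using hgood
  have hrel : ∀ P Q : Submodule R M, ∃ e : M → Set M, (∀ x, #(e x) ≤ μ) ∧
      (P ≤ Q → ModuleCat.of R (Quo P Q) ∈ leftPerp 𝒩 → ∀ S : Submodule R M,
        (∀ x ∈ S, e x ⊆ S) → ModuleCat.of R (Quo (P ⊔ S) (Q ⊔ S)) ∈ leftPerp 𝒩) := by
    intro P Q
    by_cases h : P ≤ Q ∧ ModuleCat.of R (Quo P Q) ∈ leftPerp 𝒩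
    · obtain ⟨e, he, heS⟩ := (hHill _ h.2).exists_relative h.1
      exact ⟨e, he, fun _ _ => heS⟩
    · exact ⟨fun _ => ∅, fun _ => by simp, fun h₁ h₂ => absurd ⟨h₁, h₂⟩ h⟩
  choose e heμ he using hrel
  -- At each stage there are a submodule `A i` for each `i` and closure operations `E i`, namely
  -- all the Hill operations of the quotients of consecutive stages so far.
  let Y (A : I → Submodule R M) (E : I → M → Set M) (i : I) : Set M :=
    X i ∪ (⋃ j : Iic i, (A j : Set M)) ∪ ⋃ k, ⋃ x : A i, E k x
  let st : ℕ → (I → Submodule R M) × (I → M → Set M) := fun n => Nat.rec (fun _ => ⊥, fun _ _ => ∅)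
    (fun _ p => (fun i => g i (Y p.1 p.2 i),
      fun k x => p.2 k x ∪ e (p.1 k) (g k (Y p.1 p.2 k)) x)) n
  let A : ℕ → I → Submodule R M := fun n => (st n).1
  let E : ℕ → I → M → Set M := fun n => (st n).2
  have hA₀ : ∀ i, A 0 i = ⊥ := fun i => rfl
  have hA₁ : ∀ n i, A (n + 1) i = g i (Y (A n) (E n) i) := fun n i => rfl
  have hE₁ : ∀ n k x, E (n + 1) k x = E n k x ∪ e (A n k) (A (n + 1) k) x := fun n k x => rfl
  have hEμ : ∀ n k x, #(E n k x) ≤ μ := by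
    intro n k x
    induction n with
    | zero => simp [E, st]
    | succ n ihn =>
      rw [hE₁]
      exact (mk_union_le _ _).trans (add_le_of_le hμ ihn (heμ _ _ _))
  have hY : ∀ n i, (∀ j, #(A n j) ≤ ℓ j) → #(Y (A n) (E n) i) ≤ ℓ i := by
    intro n i h
    refine (mk_union_le _ _).trans (add_le_of_le (hℵℓ i)
      ((mk_union_le _ _).trans (add_le_of_le (hℵℓ i) (hXℓ i) ?_)) ?_)
    · exact mk_iUnion_le_of_le (hℵℓ i) (by simpa using (mk_set_le _).trans (hIℓ i))
        fun j => (h j).trans (hℓ j.2)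
    · exact mk_iUnion_le_of_le (hℵℓ i) (by simpa using hIℓ i) fun k =>
        mk_iUnion_le_of_le (hℵℓ i) (by simpa using h i) fun x => (hEμ n k x).trans (hμℓ i)
  have hAgood : ∀ n i, IsGood (ℓ i) 𝒜 (A n i) := by
    intro n
    induction n with
    | zero =>
      intro i
      exact ⟨(mk_le_one_iff_set_subsingleton.2 (by simp [hA₀])).trans
        (one_le_aleph0.trans (hℵℓ i)), fun A' _ _ => quo_bot_mem h𝒜 hM (hA₀ i)⟩
    | succ n ihn =>
      intro i
      rw [hA₁]
      exact (hg i _ (hY n i fun j => (ihn j).1)).2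
  have hYA : ∀ n i, Y (A n) (E n) i ⊆ A (n + 1) i := fun n i =>
    (hg i _ (hY n i fun j => (hAgood n j).1)).1
  have hAle : ∀ n, ∀ j i, j ≤ i → A n j ≤ A (n + 1) i := fun n j i h x hx =>
    hYA n i (.inl (.inr (mem_iUnion.2 ⟨⟨j, h⟩, hx⟩)))
  have hAmono : ∀ i, Monotone fun n => A n i := fun i =>
    monotone_nat_of_le_succ fun n => hAle n i i le_rfl
  have hEmono : ∀ k x, Monotone fun n => E n k x := fun k x =>
    monotone_nat_of_le_succ fun n => (hE₁ n k x).symm ▸ subset_union_left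
  have hAQ : ∀ n i, ModuleCat.of R (Quo (A n i) (A (n + 1) i)) ∈ leftPerp 𝒩 := fun n i =>
    hsmall _ _ ((hAgood (n + 1) i).1.trans_lt (hℓM i))
      ((hAgood n i).2 _ (hAle n i i le_rfl) (hAgood (n + 1) i).1)
  let N : I → Submodule R M := fun i => ⨆ n, A n i
  have hN : ∀ i x, x ∈ N i ↔ ∃ n, x ∈ A n i := fun i x =>
    Submodule.mem_iSup_of_directed _ (directed_of_isDirected_le (hAmono i))
  have hNmono : Monotone N := by
    intro j i h x hx
    obtain ⟨n, hn⟩ := (hN j x).1 hx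
    exact (hN i x).2 ⟨n + 1, hAle n j i h hn⟩
  have hNcard : ∀ i, #(N i) < #M := by
    intro i
    have : (N i : Set M) = ⋃ n, (A n i : Set M) := by
      ext x
      simpa using hN i x
    change #(N i : Set M) < _
    rw [this]
    exact (mk_iUnion_le_of_countable (hℵℓ i) fun n => (hAgood n i).1).trans_lt (hℓM i)
  have hNcl : ∀ j n i, ∀ x ∈ N j, e (A n i) (A (n + 1) i) x ⊆ N j := by
    intro j n i x hx y hy
    obtain ⟨m, hm⟩ := (hN j x).1 hx
    refine (hN j y).2 ⟨max m (n + 1) + 1, hYA _ _ (.inr (mem_iUnion₂.2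
      ⟨i, ⟨x, hAmono j (le_max_left m (n + 1)) hm⟩, ?_⟩))⟩
    refine hEmono i x (le_max_right m (n + 1)) ?_
    exact (hE₁ n i x).ge (Or.inr hy)
  choose D hD using exists_union_lt hNmono
  refine mem_leftPerp_iff.2 fun N' hN' => Orth.of_chain hNmono hD (fun x => ?_) fun i => ?_
  · obtain ⟨i, hi⟩ := hX x
    exact ⟨i, (hN i x).2 ⟨1, hYA 0 i (.inl (.inl hi))⟩⟩
  · have hNi : ModuleCat.of R (N i) ∈ leftPerp 𝒩 := ih _ (hsub _) (hNcard i)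
    by_cases hi : ∃ j, j < i
    · -- Filter `N i / D i` by the images of the stages `A n i`.
      obtain ⟨j₀, hj₀⟩ := hi
      have hDN : D i ≤ N i := by
        intro x hx
        rcases (hD i x).1 hx with rfl | ⟨j, hj, hx⟩
        · exact zero_mem _
        · exact hNmono hj.le hx
      have hDcl : ∀ n, ∀ x ∈ D i, e (A n i) (A (n + 1) i) x ⊆ D i := by
        intro n x hx y hy
        have : ∃ j < i, x ∈ N j := by
          rcases (hD i x).1 hx with rfl | h
          · exact ⟨j₀, hj₀, zero_mem _⟩
          · exact h
        obtain ⟨j, hj, hx⟩ := this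
        exact (hD i y).2 (.inr ⟨j, hj, hNcl j n i x hx hy⟩)
      refine Orth.quo_of_chain (I := ℕ) (G := fun n => A (n + 1) i ⊔ D i)
        (D := fun n => A n i ⊔ D i)
        (fun m n h => sup_le_sup_right (hAmono i (Nat.succ_le_succ h)) _)
        (fun n => le_sup_right) (fun n x => ?_) (fun x => ?_)
        (fun n => he _ _ (hAle n i i le_rfl) (hAQ n i) _ (hDcl n) N' hN') (hNi N' hN')
      · constructor
        · intro hx
          cases n with
          | zero => exact .inl (by simpa [hA₀] using hx)
          | succ n => exact .inr ⟨n, n.lt_succ_self, hx⟩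
        · rintro (hx | ⟨m, hm, hx⟩)
          · exact Submodule.mem_sup_right hx
          · exact sup_le_sup_right (hAmono i (Nat.succ_le_of_lt hm)) _ hx
      · constructor
        · intro hx
          obtain ⟨n, hn⟩ := (hN i x).1 hx
          exact .inr ⟨n, Submodule.mem_sup_left (hAmono i n.le_succ hn)⟩
        · rintro (hx | ⟨n, hx⟩)
          · exact hDN hx
          · refine (sup_le ?_ hDN : A (n + 1) i ⊔ D i ≤ N i) hx
            exact le_iSup (fun n => A n i) (n + 1)
    · refine hsmall _ _ (hNcard i) (quo_bot_mem h𝒜 hM ?_) N' hN'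
      rw [eq_bot_iff]
      intro x hx
      rcases (hD i x).1 hx with rfl | ⟨j, hj, -⟩
      · exact zero_mem _
      · exact absurd ⟨j, hj⟩ hi

end Singular

/-! ### The weak diamond at regular cardinals -/

section WeakDiamond

variable {R : Type u} [Ring R] {M : Type u} [AddCommGroup M] [Module R M]
  {B : Type u} [AddCommGroup B] [Module R B]

/-- The relations among the elements of the submodule `A`. -/
noncomputable def relationsIn (A : Submodule R M) : Submodule R (M →₀ R) :=
  relations R M ⊓ Finsupp.supported R R (A : Set M)

theorem mem_relationsIn {A : Submodule R M} {x : M →₀ R} :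
    x ∈ relationsIn A ↔ x ∈ relations R M ∧ ∀ m ∈ x.support, m ∈ A :=
  Iff.rfl

theorem relationsIn_mono {A A' : Submodule R M} (h : A ≤ A') : relationsIn A ≤ relationsIn A' :=
  fun _ hx => ⟨hx.1, fun _ hm => h (hx.2 hm)⟩

theorem exists_mem_relationsIn_of_directed {I : Type*} [LinearOrder I] [Nonempty I]
    {A : I → Submodule R M} (hA : Monotone A) {x : M →₀ R} (hx : x ∈ relations R M)
    (h : ∀ m ∈ x.support, ∃ i, m ∈ A i) : ∃ i, x ∈ relationsIn (A i) := by
  choose i hi using h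
  obtain ⟨j, hj⟩ := Finite.exists_le fun m : x.support => i m m.2
  exact ⟨j, hx, fun m hm => hA (hj ⟨m, hm⟩) (hi m hm)⟩

/-- The quotient of the relations in `A'` by the relations in `A` embeds in a free module, so it is
orthogonal to modules of injective dimension at most one. -/
theorem orth_quo_relationsIn (hB : HasInjectiveDimensionLE (ModuleCat.of R B) 1)
    (A A' : Submodule R M) : Orth R (Quo (relationsIn A) (relationsIn A')) B := by
  classical
  let ψ : (M →₀ R) →ₗ[R] (M →₀ R) :=
    Finsupp.linearCombination R fun m => if m ∈ A then 0 else Finsupp.single m 1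
  have hψ : ∀ x m, ψ x m = if m ∈ A then 0 else x m := by
    intro x m
    induction x using Finsupp.induction_linear with
    | zero => simp
    | add x y hx hy =>
      rw [map_add, Finsupp.add_apply, hx, hy]
      split_ifs <;> simp
    | single n r =>
      simp only [ψ, Finsupp.linearCombination_single]
      by_cases hnm : n = m
      · subst hnm
        split_ifs <;> simp
      · split_ifs <;> simp [hnm]
  let φ : relationsIn A' →ₗ[R] (M →₀ R) := ψ.comp (relationsIn A').subtype
  have hker : ∀ x, φ.rangeRestrict x = 0 ↔ (x : M →₀ R) ∈ relationsIn A := by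
    intro x
    rw [Subtype.ext_iff, mem_relationsIn]
    change ψ x = 0 ↔ _
    constructor
    · intro h
      refine ⟨x.2.1, fun m hm => ?_⟩
      by_contra hmA
      have := hψ x m
      rw [h, if_neg hmA] at this
      exact Finsupp.mem_support_iff.1 hm this.symm
    · rintro ⟨-, h⟩
      ext m
      rw [hψ]
      by_cases hm : (x : M →₀ R) m = 0
      · simp [hm]
      · rw [if_pos (h m (Finsupp.mem_support_iff.2 hm))]
        rfl
  obtain ⟨e⟩ := nonempty_quo_equiv_of_surjective (R := R) (M := M →₀ R) (Y := LinearMap.range φ)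
    (P := relationsIn A) (Q := relationsIn A') φ.rangeRestrict φ.surjective_rangeRestrict hker
  have horth : Orth R (LinearMap.range φ) B :=
    Orth.of_injective (B := M →₀ R) orth_of_projective hB (LinearMap.range φ).subtype
      Subtype.val_injective
  exact horth.congr e.symm

theorem linearCombination_congr_of_mem_relationsIn {A : Submodule R M} {s t : M → B}
    (h : ∀ m ∈ A, s m = t m) {x : M →₀ R} (hx : x ∈ relationsIn A) :
    Finsupp.linearCombination R s x = Finsupp.linearCombination R t x :=
  Finset.sum_congr rfl fun m hm => congrArg (x m • ·) (h m (hx.2 hm))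

/-- If `Ext¹(A' / A, B) ≠ 0`, then there is a map `δ` on relations in `A'` that vanishes on the
relations in `A` and is not split by any function vanishing on `A`. -/
theorem exists_nonsplit {A A' : Submodule R M} (hA : A ≤ A') (hA' : Orth R A' B)
    (h : ¬ Orth R (Quo A A') B) : ∃ δ : (M →₀ R) →ₗ[R] B, (∀ k ∈ relationsIn A, δ k = 0) ∧
      ∀ s : M → B, (∀ m ∈ A, s m = 0) →
        ∃ k ∈ relationsIn A', δ k ≠ Finsupp.linearCombination R s k := by
  classical
  obtain ⟨f, hf⟩ : ∃ f : A →ₗ[R] B, ∀ g : A' →ₗ[R] B, ∃ x, ∃ hx : x ∈ A,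
      g ⟨x, hA hx⟩ ≠ f ⟨x, hx⟩ := by
    by_contra! hc
    exact h (hA'.quo_of_extend hA hc)
  let s₀ : M → B := fun m => if hm : m ∈ A then f ⟨m, hm⟩ else 0
  refine ⟨Finsupp.linearCombination R s₀, fun k hk => ?_, fun s hs => ?_⟩
  · have hk0 : (∑ m : k.support, k m • (⟨m, hk.2 m.2⟩ : A)) = 0 := by
      ext
      simp only [Submodule.coe_sum, Submodule.coe_smul, Submodule.coe_zero]
      rw [Finset.sum_coe_sort k.support fun m => k m • m]
      exact LinearMap.mem_ker.1 hk.1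
    rw [← f.map_zero, ← hk0, map_sum, Finsupp.linearCombination_apply, Finsupp.sum,
      ← Finset.sum_coe_sort]
    refine Finset.sum_congr rfl fun m _ => ?_
    have hm : (m : M) ∈ A := hk.2 m.2
    rw [map_smul]
    exact congrArg (k m • ·) (dif_pos hm)
  · by_contra! hc
    have hc' : ∀ k ∈ relationsIn A', Finsupp.linearCombination R (fun m => s₀ m - s m) k = 0 := by
      intro k hk
      have : Finsupp.linearCombination R (fun m => s₀ m - s m) =
          Finsupp.linearCombination R s₀ - Finsupp.linearCombination R s := by
        ext m
        simp
      rw [this, LinearMap.sub_apply, hc k hk, sub_self]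
    let g : A' →ₗ[R] B :=
      { toFun := fun x => s₀ x - s x
        map_add' := fun x y => by
          have := hc' (Finsupp.single ((x : M) + y) 1 - Finsupp.single (x : M) 1 -
            Finsupp.single (y : M) 1) ⟨by simp, by
              refine sub_mem (sub_mem ?_ ?_) ?_
              · exact Finsupp.single_mem_supported R 1 (A'.add_mem x.2 y.2)
              · exact Finsupp.single_mem_supported R 1 x.2
              · exact Finsupp.single_mem_supported R 1 y.2⟩
          rw [map_sub, map_sub, sub_sub, sub_eq_zero] at this
          simpa using this
        map_smul' := fun r x => by
          have := hc' (Finsupp.single (r • (x : M)) 1 - Finsupp.single (x : M) r) ⟨by simp, by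
              refine sub_mem ?_ ?_
              · exact Finsupp.single_mem_supported R 1 (A'.smul_mem r x.2)
              · exact Finsupp.single_mem_supported R r x.2⟩
          rw [map_sub, sub_eq_zero] at this
          simpa using this }
    obtain ⟨x, hx, hne⟩ := hf g
    refine hne ?_
    change s₀ x - s x = _
    rw [hs x hx, sub_zero]
    exact dif_pos hx

variable {κ : Cardinal.{u}}

/-- **Weak diamond and `Ext`.** If the consecutive quotients `A' / A` of a continuous chain
of small submodules with union `M` satisfy `Ext¹(A' / A, B) ≠ 0` at stationarily many places,
then `Ext¹(M, B) ≠ 0`. A linear map `c` on the relations of `M` is built along the chain;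
at each of these places there are two choices for its next value, no splitting of the part
built so far extends to a splitting of both, and the weak diamond tells which one to take. -/
theorem not_orth_of_weakDiamondAt (hκ : κ.IsRegular) (hM : #M ≤ κ)
    {S : Set κ.ord.ToType} (hΦ : WeakDiamondAt κ S) {A : κ.ord.ToType → Submodule R M}
    (hmono : Monotone A) (hA : ∀ α, #(A α) < κ)
    (hlim : ∀ α, Order.IsSuccLimit α → ∀ x ∈ A α, ∃ β < α, x ∈ A β) (hcover : ∀ x, ∃ α, x ∈ A α)
    (hBκ : #B < κ) (hB : HasInjectiveDimensionLE (ModuleCat.of R B) 1)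
    (hAB : ∀ α, Orth R (A (Order.succ α)) B)
    (hS : ∀ α ∈ S, ¬ Orth R (Quo (A α) (A (Order.succ α))) B) : ¬ Orth R M B := by
  classical
  intro horth
  have hnomax := noMaxOrder hκ.aleph0_le
  have hne : Nonempty κ.ord.ToType := by
    rw [← mk_ne_zero_iff, mk_toType, card_ord]
    exact hκ.pos.ne'
  obtain ⟨α₀, -, hα₀⟩ := (wellFounded_lt (α := κ.ord.ToType)).has_min univ univ_nonempty
  have hα₀le : ∀ β, α₀ ≤ β := fun β => not_lt.1 (hα₀ β trivial)
  have hsucc : ∀ α : κ.ord.ToType, α < Order.succ α := Order.lt_succ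
  let D : κ.ord.ToType → Submodule R (M →₀ R) := fun α => relationsIn (A α)
  let G : κ.ord.ToType → Submodule R (M →₀ R) := fun α => relationsIn (A (Order.succ α))
  have hDG : ∀ α, D α ≤ G α := fun α => relationsIn_mono (hmono (hsucc α).le)
  have hD : ∀ α x, x ∈ D α ↔ x ∈ D α₀ ∨ ∃ β < α, x ∈ G β := by
    intro α x
    constructor
    · intro hx
      by_cases hmin : IsMin α
      · have : α = α₀ := le_antisymm (hmin (hα₀le α)) (hα₀le α)
        exact .inl (this ▸ hx)
      by_cases hpre : Order.IsSuccPrelimit α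
      · obtain ⟨β, hβ⟩ := not_isMin_iff.1 hmin
        have : Nonempty (Iio α) := ⟨⟨β, hβ⟩⟩
        obtain ⟨γ, hγ⟩ := exists_mem_relationsIn_of_directed (A := fun γ : Iio α => A γ)
          (fun _ _ h => hmono h) hx.1 fun m hm => by
            obtain ⟨γ, hγ, hm⟩ := hlim α ⟨hmin, hpre⟩ m (hx.2 hm)
            exact ⟨⟨γ, hγ⟩, hm⟩
        exact .inr ⟨γ, γ.2, hDG _ hγ⟩
      · simp only [Order.IsSuccPrelimit, not_forall, not_not] at hpre
        obtain ⟨β, hβ⟩ := hpre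
        refine .inr ⟨β, hβ.lt, ?_⟩
        change x ∈ relationsIn (A (Order.succ β))
        rwa [hβ.succ_eq]
    · rintro (hx | ⟨β, hβ, hx⟩)
      · exact relationsIn_mono (hmono (hα₀le α)) hx
      · exact relationsIn_mono (hmono (Order.succ_le_of_lt hβ)) hx
  have hT : ∀ x, x ∈ relations R M ↔ x ∈ D α₀ ∨ ∃ β, x ∈ G β := by
    intro x
    constructor
    · intro hx
      obtain ⟨γ, hγ⟩ := exists_mem_relationsIn_of_directed hmono hx fun m _ => hcover m
      exact .inr ⟨γ, hDG _ hγ⟩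
    · rintro (hx | ⟨β, hx⟩)
      · exact hx.1
      · exact hx.1
  choose E₀ hE₀ using fun α (f : D α →ₗ[R] B) =>
    (orth_quo_relationsIn hB (A α) (A (Order.succ α))).exists_extend_quo (hDG α) f
  choose δ hδ₀ hδ using fun α : S =>
    exists_nonsplit (hmono (hsucc α.1).le) (hAB α.1) (hS α.1 α.2)
  -- A subset of `M × B` is read as a function `M → B`.
  let dec : Set (M × B) → M → B := fun Y m => if h : ∃ b, (m, b) ∈ Y then h.choose else 0
  let F : κ.ord.ToType → Set (M × B) := fun α => {p | p.1 ∈ A α}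
  have hF : IsKappaFiltration κ (M × B) F :=
    { iUnion_eq := by
        ext p
        simpa [F] using hcover p.1
      mk_lt := fun α => by
        have : #(F α) ≤ #(A α × B) := mk_le_of_injective
          (f := fun p : F α => ((⟨p.1.1, p.2⟩ : A α), p.1.2)) fun p q h => by
            simp only [Prod.mk.injEq, Subtype.mk.injEq] at h
            exact Subtype.ext (Prod.ext h.1 h.2)
        refine this.trans_lt ?_
        simpa using mul_lt_of_lt hκ.aleph0_le (hA α) hBκ
      subset_succ := fun α p hp => hmono (hsucc α).le hp
      eq_of_isSuccLimit := fun α hα => by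
        ext p
        simp only [F, mem_ofPred_eq, mem_iUnion, mem_Iio, exists_prop]
        exact ⟨hlim α hα p.1, fun ⟨β, hβ, h⟩ => hmono hβ.le h⟩ }
  -- The colouring: does the splitting `s` of the part built so far extend along the default choice?
  let Ext (α : κ.ord.ToType) (s : M → B) : Prop :=
    ∃ s' : M → B, (∀ m ∈ A α, s' m = s m) ∧ ∀ k : G α, Finsupp.linearCombination R s' k =
      E₀ α ((Finsupp.linearCombination R s).comp (D α).subtype) k
  have hExt : ∀ α s t, (∀ m ∈ A α, s m = t m) → Ext α s → Ext α t := by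
    rintro α s t hst ⟨s', hs', hk⟩
    refine ⟨s', fun m hm => (hs' m hm).trans (hst m hm), fun k => ?_⟩
    have : (Finsupp.linearCombination R t).comp (D α).subtype =
        (Finsupp.linearCombination R s).comp (D α).subtype := by
      refine LinearMap.ext fun x => ?_
      exact (linearCombination_congr_of_mem_relationsIn hst x.2).symm
    rw [this]
    exact hk k
  obtain ⟨φ, hφ⟩ := hΦ (M × B) F
    (by simpa using mul_le_of_le hκ.aleph0_le hM hBκ.le) hF
    fun α Y => decide (Ext α (dec Y))
  obtain ⟨c, -, hc⟩ := exists_linearMap_of_chain (K := D α₀) (G := G) (D := D)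
    (T := relations R M) (N := B)
    (fun α β h => relationsIn_mono (hmono (Order.succ_le_succ h)))
    (fun α => relationsIn_mono (hmono (hα₀le _))) hD hT 0
    (fun α f => E₀ α f + if h : α ∈ S then
      (if φ ⟨α, h⟩ then (δ ⟨α, h⟩).comp (G α).subtype else 0) else 0)
    (fun α f x hx hx' => by
      rw [LinearMap.add_apply, hE₀ α f x hx]
      by_cases h : α ∈ S
      · rw [dif_pos h]
        split_ifs
        · exact (congrArg _ (hδ₀ ⟨α, h⟩ x hx)).trans (add_zero _)
        · exact add_zero _
      · rw [dif_neg h]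
        exact add_zero _)
  obtain ⟨g, hg⟩ := orth_iff_extend.1 horth c
  let s : M → B := fun m => g (Finsupp.single m 1)
  have hs : Finsupp.linearCombination R s = g := by
    ext m
    simp [s]
  obtain ⟨α, hα, hPφ⟩ := (hφ {p | p.2 = s p.1}).nonempty
  have hdec : ∀ m ∈ A α, dec ({p | p.2 = s p.1} ∩ F α) m = s m := by
    intro m hm
    have hex : ∃ b, (m, b) ∈ {p : M × B | p.2 = s p.1} ∩ F α := ⟨s m, rfl, hm⟩
    exact (dif_pos hex).trans hex.choose_spec.1
  have hGT : G α ≤ relations R M := fun x hx => hx.1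
  have hDT : D α ≤ relations R M := fun x hx => hx.1
  have hcD : c.comp (Submodule.inclusion hDT) =
      (Finsupp.linearCombination R s).comp (D α).subtype := by
    refine LinearMap.ext fun x => ?_
    rw [hs]
    exact (hg (Submodule.inclusion hDT x)).symm
  have hcG : ∀ k : G α, Finsupp.linearCombination R s k =
      E₀ α ((Finsupp.linearCombination R s).comp (D α).subtype) k +
        (if φ ⟨α, hα⟩ then δ ⟨α, hα⟩ k else 0) := by
    intro k
    have := LinearMap.congr_fun (hc α hGT hDT) k
    rw [dif_pos hα, hcD, LinearMap.add_apply] at this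
    refine (LinearMap.congr_fun hs k).trans
      ((hg (Submodule.inclusion hGT k)).trans (this.trans ?_))
    congr 1
    split_ifs <;> rfl
  cases hval : φ ⟨α, hα⟩ with
  | true =>
    rw [hval, decide_eq_true_eq] at hPφ
    obtain ⟨s', hs', hk⟩ := hExt α _ s hdec hPφ
    obtain ⟨k, hkG, hkne⟩ := hδ ⟨α, hα⟩ (fun m => s m - s' m) fun m hm => by
      rw [hs' m hm, sub_self]
    refine hkne ?_
    have h₁ := hcG ⟨k, hkG⟩
    rw [if_pos hval, ← hk ⟨k, hkG⟩] at h₁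
    have : Finsupp.linearCombination R (fun m => s m - s' m) =
        Finsupp.linearCombination R s - Finsupp.linearCombination R s' := by
      ext m
      simp
    rw [this, LinearMap.sub_apply]
    exact (sub_eq_of_eq_add' h₁).symm
  | false =>
    rw [hval, decide_eq_false_iff_not] at hPφ
    refine hPφ (hExt α s _ (fun m hm => (hdec m hm).symm) ⟨s, fun _ _ => rfl, fun k => ?_⟩)
    rw [hcG k, if_neg (by simp [hval]), add_zero]

/-- The step at regular cardinals: if `M` is orthogonal to a small family `T` of modules of
injective dimension at most one, then all consecutive quotients of some filtration of `M` by
smaller submodules are orthogonal to `T`. -/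
theorem mem_leftPerp_of_isRegular (hΦ : WeakDiamond.{u}) {ι : Type u} {T : ι → ModuleCat.{u} R}
    {𝒩 : Set (ModuleCat.{u} R)} (hT : range T ⊆ injDimLE R 1)
    (hM : ModuleCat.of R M ∈ leftPerp (range T)) (hreg : (#M).IsRegular) (h₀ : ℵ₀ < #M)
    (hR : #R < #M) (hι : #ι < #M) (hTM : ∀ i, #(T i) < #M)
    (ih : ∀ (X : Type u) [AddCommGroup X] [Module R X], ModuleCat.of R X ∈ leftPerp (range T) →
      #X < #M → ModuleCat.of R X ∈ leftPerp 𝒩) :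
    ModuleCat.of R M ∈ leftPerp 𝒩 := by
  classical
  have h𝒜 := isSubmoduleClosed_leftPerp hT
  have hsub : ∀ A : Submodule R M, ModuleCat.of R A ∈ leftPerp (range T) := fun A =>
    h𝒜 A.subtype Subtype.val_injective hM
  obtain ⟨f⟩ := Cardinal.eq.1 (show #(#M).ord.ToType = #M by simp)
  -- The next member of the filtration witnesses, if possible, that some quotient is bad.
  have hnx : ∀ P : Submodule R M, #P < #M → ∃ Q, P ≤ Q ∧ #Q < #M ∧
      (ModuleCat.of R (Quo P Q) ∈ leftPerp (range T) → ∀ Q', P ≤ Q' → #Q' < #M →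
        ModuleCat.of R (Quo P Q') ∈ leftPerp (range T)) := by
    intro P hP
    by_cases h : ∃ Q, P ≤ Q ∧ #Q < #M ∧ ModuleCat.of R (Quo P Q) ∉ leftPerp (range T)
    · obtain ⟨Q, h₁, h₂, h₃⟩ := h
      exact ⟨Q, h₁, h₂, fun h => absurd h h₃⟩
    · push Not at h
      exact ⟨P, le_rfl, hP, fun _ => h⟩
  choose nx hnx₁ hnx₂ hnx₃ using hnx
  have hspan : ∀ x : M, #(Submodule.span R {x}) < #M := fun x =>
    mk_span_le.trans_lt (max_lt (max_lt (by simpa using one_lt_aleph0.trans h₀) hR) h₀)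
  obtain ⟨A, hmono, hA, hstep, hlim⟩ := exists_continuous_chain (M := M) hreg h₀ hR
    (fun α P => (if h : #P < #M then nx P h else P) ⊔ Submodule.span R {f α}) (by
      intro α P hP
      rw [dif_pos hP]
      exact mk_sup_lt h₀.le (hnx₂ P hP) (hspan _))
  have hnomax := noMaxOrder hreg.aleph0_le
  have hsucc : ∀ α : (#M).ord.ToType, α < Order.succ α := Order.lt_succ
  have hnxA : ∀ α, nx (A α) (hA α) ≤ A (Order.succ α) := by
    intro α
    have := hstep α _ (hsucc α)
    rw [dif_pos (hA α)] at this
    exact le_sup_left.trans this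
  have hcover : ∀ x, ∃ α, x ∈ A α := by
    intro x
    refine ⟨_, hstep (f.symm x) _ (hsucc _) (Submodule.mem_sup_right ?_)⟩
    rw [f.apply_symm_apply]
    exact Submodule.mem_span_singleton_self x
  let S : ι → Set (#M).ord.ToType := fun i => {α | ¬ Orth R (Quo (A α) (A (Order.succ α))) (T i)}
  have hcof : Order.cof (#M).ord.ToType = #M := by rw [Ordinal.cof_toType, hreg.cof_ord]
  by_cases hstat : IsStationary (⋃ i, S i)
  · rw [isStationary_iUnion_iff (by rw [hcof]; exact h₀.ne')
      (by rw [hcof]; simpa using hι)] at hstat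
    obtain ⟨i, hi⟩ := hstat
    exact absurd (hM (T i) ⟨i, rfl⟩) (not_orth_of_weakDiamondAt hreg le_rfl
      (hΦ _ hreg h₀ _ hi) hmono hA hlim hcover (hTM i) (hT ⟨i, rfl⟩)
      (fun α => hsub _ (T i) ⟨i, rfl⟩) fun α hα => hα)
  · obtain ⟨C, hC, hdisj⟩ := not_isStationary_iff.1 hstat
    have hquo : ∀ α ∈ C, ∀ Q, A α ≤ Q → #Q < #M →
        ModuleCat.of R (Quo (A α) Q) ∈ leftPerp (range T) := by
      intro α hα
      refine hnx₃ (A α) (hA α) (quo_mem_of_le h𝒜 (hnxA α) ?_)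
      rintro _ ⟨i, rfl⟩
      by_contra h
      exact disjoint_right.1 hdisj hα (mem_iUnion.2 ⟨i, h⟩)
    have hCmono : Monotone fun i : C => A i := fun i j h => hmono h
    choose D hD using exists_union_lt hCmono
    refine mem_leftPerp_iff.2 fun N hN => Orth.of_chain hCmono hD (fun x => ?_) fun i => ?_
    · obtain ⟨α, hα⟩ := hcover x
      obtain ⟨β, hβ, hαβ⟩ := hC.isCofinal α
      exact ⟨⟨β, hβ⟩, hmono hαβ hα⟩
    · suffices h : ModuleCat.of R (Quo (D i) (A i)) ∈ leftPerp (range T) from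
        ih _ h (mk_quo_le.trans_lt (hA i)) N hN
      by_cases hi : ∃ j, j < i
      · obtain ⟨j₀, hj₀⟩ := hi
        -- The supremum `γ` of the predecessors of `i` in `C` belongs to `C`.
        obtain ⟨γ, hγ, hmin⟩ := (wellFounded_lt (α := (#M).ord.ToType)).has_min
          {γ | ∀ j : C, j < i → (j : (#M).ord.ToType) ≤ γ} ⟨i, fun j hj => hj.le⟩
        have hγi : γ ≤ i := not_lt.1 (hmin i fun j hj => hj.le)
        have hex : ∀ β < γ, ∃ j : C, j < i ∧ β < j := by
          intro β hβ
          by_contra! h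
          exact hmin β h hβ
        have hγC : γ ∈ C := by
          refine hC.isLUB_mem (t := Subtype.val '' Iio i) ?_ ⟨j₀, j₀, hj₀, rfl⟩ ⟨?_, fun b hb => ?_⟩
          · rintro _ ⟨j, -, rfl⟩
            exact j.2
          · rintro _ ⟨j, hj, rfl⟩
            exact hγ j hj
          · exact not_lt.1 (hmin b fun j hj => hb ⟨j, hj, rfl⟩)
        have hDγ : D i = A γ := by
          refine le_antisymm (fun x hx => ?_) fun x hx => (hD i x).2 (.inr ?_)
          · rcases (hD i x).1 hx with rfl | ⟨j, hj, hx⟩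
            · exact zero_mem _
            · exact hmono (hγ j hj) hx
          · by_cases hγlt : γ < i
            · exact ⟨⟨γ, hγC⟩, hγlt, hx⟩
            · have hlt : ∀ j : C, j < i → (j : (#M).ord.ToType) < γ := fun j hj =>
                lt_of_lt_of_le hj (not_lt.1 hγlt)
              obtain ⟨β, hβ, hxβ⟩ := hlim γ ⟨fun h => h.not_lt (hlt j₀ hj₀), fun β hβ => by
                obtain ⟨j, hj, hβj⟩ := hex β hβ.lt
                exact hβ.2 hβj (hlt j hj)⟩ x hx
              obtain ⟨j, hj, hβj⟩ := hex β hβ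
              exact ⟨j, hj, hmono hβj.le hxβ⟩
        rw [hDγ]
        exact hquo γ hγC _ (hmono hγi) (hA i)
      · refine quo_bot_mem h𝒜 hM (eq_bot_iff.2 fun x hx => ?_)
        rcases (hD i x).1 hx with rfl | ⟨j, hj, -⟩
        · exact zero_mem _
        · exact absurd ⟨j, hj⟩ hi

end WeakDiamond

/-! ### Generation and cogeneration -/

section Generation

variable {R : Type u} [Ring R]

theorem subset_rightPerp_leftPerp (𝒞 : Set (ModuleCat.{u} R)) : 𝒞 ⊆ rightPerp (leftPerp 𝒞) :=
  fun _ hM _ hC => hC _ hM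

theorem subset_leftPerp_rightPerp (𝒞 : Set (ModuleCat.{u} R)) : 𝒞 ⊆ leftPerp (rightPerp 𝒞) :=
  fun _ hM _ hC => hC _ hM

theorem leftPerp_anti {𝒞 𝒟 : Set (ModuleCat.{u} R)} (h : 𝒞 ⊆ 𝒟) : leftPerp 𝒟 ⊆ leftPerp 𝒞 :=
  fun _ hM C hC => hM C (h hC)

theorem rightPerp_anti {𝒞 𝒟 : Set (ModuleCat.{u} R)} (h : 𝒞 ⊆ 𝒟) : rightPerp 𝒟 ⊆ rightPerp 𝒞 :=
  fun _ hM C hC => hM C (h hC)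

theorem exists_range_eq (𝒮 : Set (ModuleCat.{u} R)) [Small.{u} 𝒮] :
    ∃ (ι : Type u) (T : ι → ModuleCat.{u} R), range T = 𝒮 :=
  ⟨Shrink.{u} 𝒮, fun a => (equivShrink 𝒮).symm a, by
    rw [← Function.comp_def, (equivShrink 𝒮).symm.surjective.range_comp, Subtype.range_coe]⟩

/-- A quotient of the free module of rank `ν`. -/
abbrev FreeQuotient (ν : Cardinal.{u}) (W : Submodule R (ν.out →₀ R)) : Type u :=
  (ν.out →₀ R) ⧸ W

theorem exists_freeQuotient_equiv {ν : Cardinal.{u}} {M : Type u} [AddCommGroup M] [Module R M]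
    (hM : #M ≤ ν) : ∃ W : Submodule R (ν.out →₀ R), Nonempty (FreeQuotient ν W ≃ₗ[R] M) := by
  rw [← mk_out ν] at hM
  obtain ⟨f⟩ := hM
  have hsurj : Function.Surjective (Finsupp.linearCombination R (Function.invFun f)) :=
    (Finsupp.linearCombination_surjective R (Function.invFun_surjective f.injective))
  exact ⟨_, ⟨LinearMap.quotKerEquivOfSurjective _ hsurj⟩⟩

theorem mk_freeQuotient_le {ν : Cardinal.{u}} (hν : ℵ₀ ≤ ν) (hR : #R ≤ ν)
    (W : Submodule R (ν.out →₀ R)) : #(FreeQuotient ν W) ≤ ν :=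
  mk_quotient_le.trans (mk_finsupp_le.trans (max_le (max_le (mk_out ν).le hR) hν))

/-- Under the Weak Diamond Principle, if a small family `T ⊆ 𝒩` of modules of injective dimension at
most one suffices to detect the members of `leftPerp 𝒩` up to a certain cardinality, then it
detects all of them. -/
theorem leftPerp_range_subset (hΦ : WeakDiamond.{u}) {ι : Type u} {T : ι → ModuleCat.{u} R}
    {𝒩 : Set (ModuleCat.{u} R)} {μ κ : Cardinal.{u}} (hμ : ℵ₀ ≤ μ) (hR : #R ≤ μ) (hμκ : μ ≤ κ)
    (hι : #ι ≤ κ) (hTκ : ∀ i, #(T i) ≤ κ) (hT : range T ⊆ injDimLE R 1) (hT𝒩 : range T ⊆ 𝒩)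
    (hHill : ∀ (X : Type u) [AddCommGroup X] [Module R X], ModuleCat.of R X ∈ leftPerp 𝒩 →
      IsHill μ (leftPerp 𝒩) X)
    (hsmall : ∀ (X : Type u) [AddCommGroup X] [Module R X],
      ModuleCat.of R X ∈ leftPerp (range T) → #X ≤ κ → ModuleCat.of R X ∈ leftPerp 𝒩) :
    leftPerp (range T) ⊆ leftPerp 𝒩 := by
  suffices h : ∀ (ν : Cardinal.{u}) (X : Type u) [AddCommGroup X] [Module R X], #X = ν →
      ModuleCat.of R X ∈ leftPerp (range T) → ModuleCat.of R X ∈ leftPerp 𝒩 from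
    fun M hM => h _ M rfl hM
  intro ν
  induction ν using WellFoundedLT.induction with
  | ind ν ih =>
    rintro X _ _ rfl hX
    rcases le_or_gt #X κ with hle | hlt
    · exact hsmall X hX hle
    have h₀ : ℵ₀ < #X := (hμ.trans hμκ).trans_lt hlt
    rcases isRegular_or_isSingular h₀.le with hreg | hsing
    · exact mem_leftPerp_of_isRegular hΦ hT hX hreg h₀ ((hR.trans hμκ).trans_lt hlt)
        (hι.trans_lt hlt) (fun i => (hTκ i).trans_lt hlt) fun Y _ _ hY hYX => ih _ hYX Y rfl hY
    · exact mem_leftPerp_of_isSingular hμ hR (isSubmoduleClosed_leftPerp hT) (leftPerp_anti hT𝒩)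
        hHill hX hsing (hμκ.trans_lt hlt) fun Y _ _ hY hYX => ih _ hYX Y rfl hY

/-- A cotorsion pair cogenerated by a small family is generated by the quotients of a free module
that belong to its left class. -/
theorem isGeneratedBySet_of_isCogeneratedBySet (hΦ : WeakDiamond.{u})
    {𝒜 ℬ : Set (ModuleCat.{u} R)} (hC : IsCotorsionPair 𝒜 ℬ) (hB : ℬ ⊆ injDimLE R 1)
    (h : IsCogeneratedBySet 𝒜 ℬ) : IsGeneratedBySet 𝒜 ℬ := by
  obtain ⟨𝒯, _, h𝒯⟩ := h
  obtain ⟨ι, T, rfl⟩ := exists_range_eq 𝒯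
  have hTB : range T ⊆ ℬ := by
    rw [hC.right_eq, h𝒯]
    exact subset_rightPerp_leftPerp _
  let κ : Cardinal.{u} := max (max ℵ₀ #R) (max #ι (Cardinal.sum fun i => #(T i)))
  have h₀ : ℵ₀ ≤ κ := (le_max_left _ _).trans (le_max_left _ _)
  have hR : #R ≤ κ := (le_max_right _ _).trans (le_max_left _ _)
  have hι : #ι ≤ κ := (le_max_left _ _).trans (le_max_right _ _)
  have hTκ : ∀ i, #(T i) ≤ κ := fun i =>
    ((le_sum _ i).trans (le_max_right _ _)).trans (le_max_right _ _)
  let 𝒮 : Set (ModuleCat.{u} R) := range fun W : {W : Submodule R (κ.out →₀ R) //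
    ModuleCat.of R (FreeQuotient κ W) ∈ 𝒜} => ModuleCat.of R (FreeQuotient κ W.1)
  have h𝒮 : 𝒮 ⊆ 𝒜 := by
    rintro _ ⟨W, rfl⟩
    exact W.2
  have hB𝒮 : ℬ ⊆ rightPerp 𝒮 := hC.right_eq.subset.trans (rightPerp_anti h𝒮)
  refine ⟨𝒮, small_range _, hB𝒮.antisymm ?_⟩
  have hsub : leftPerp (range T) ⊆ leftPerp (rightPerp 𝒮) := by
    refine leftPerp_range_subset hΦ h₀ hR le_rfl hι hTκ (hTB.trans hB) (hTB.trans hB𝒮)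
      (fun X _ _ hX => isHill_of_mem_leftPerp_rightPerp h₀ hR ?_ X hX) fun X _ _ hX hXκ => ?_
    · rintro _ ⟨W, rfl⟩
      exact mk_freeQuotient_le h₀ hR W.1
    · obtain ⟨W, ⟨e⟩⟩ := exists_freeQuotient_equiv (R := R) hXκ
      refine mem_leftPerp_congr e (subset_leftPerp_rightPerp _ ⟨⟨W, ?_⟩, rfl⟩)
      rw [h𝒯]
      exact mem_leftPerp_congr e.symm hX
  calc rightPerp 𝒮 ⊆ rightPerp (leftPerp (rightPerp 𝒮)) := subset_rightPerp_leftPerp _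
    _ ⊆ rightPerp 𝒜 := rightPerp_anti (h𝒯.subset.trans hsub)
    _ = ℬ := hC.right_eq.symm

/-- The supremum of a strictly increasing sequence of infinite cardinals is singular. -/
theorem isSingular_iSup_nat {k : ℕ → Cardinal.{u}} (h₀ : ℵ₀ ≤ k 0) (hk : ∀ n, k n < k (n + 1)) :
    (⨆ n, k n).IsSingular := by
  have hle : ∀ n, k n ≤ ⨆ n, k n := fun n => le_ciSup (bddAbove_of_small (s := range k)) n
  have hlt : ∀ n, k n < ⨆ n, k n := fun n => (hk n).trans_le (hle _)
  refine (isRegular_or_isSingular (h₀.trans (hle 0))).resolve_left fun hreg => ?_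
  refine (lift_iSup_lt_of_lt_cof_ord ?_ hlt).false
  rw [lift_uzero, hreg.cof_ord, mk_nat, lift_aleph0]
  exact h₀.trans_lt (hlt 0)

/-- A cotorsion pair generated by a small family is cogenerated by a small family: take modules
that detect the quotients of free modules not in the left class, for free modules of ranks
below a cardinal `κ` of cofinality `ℵ₀` that bounds the number and the size of these modules.
Modules of cardinality `κ` itself need no detection, by singular compactness. -/
theorem isCogeneratedBySet_of_isGeneratedBySet (hΦ : WeakDiamond.{u})
    {𝒜 ℬ : Set (ModuleCat.{u} R)} (hC : IsCotorsionPair 𝒜 ℬ) (hB : ℬ ⊆ injDimLE R 1)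
    (h : IsGeneratedBySet 𝒜 ℬ) : IsCogeneratedBySet 𝒜 ℬ := by
  obtain ⟨𝒮, _, h𝒮⟩ := h
  obtain ⟨ι, A, rfl⟩ := exists_range_eq 𝒮
  let μ : Cardinal.{u} := max (max ℵ₀ #R) (Cardinal.sum fun i => #(A i))
  have hμ : ℵ₀ ≤ μ := (le_max_left _ _).trans (le_max_left _ _)
  have hR : #R ≤ μ := (le_max_right _ _).trans (le_max_left _ _)
  have hHill : ∀ (X : Type u) [AddCommGroup X] [Module R X], ModuleCat.of R X ∈ leftPerp ℬ →
      IsHill μ (leftPerp ℬ) X := by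
    rw [h𝒮]
    refine fun X _ _ => isHill_of_mem_leftPerp_rightPerp hμ hR ?_ X
    rintro _ ⟨i, rfl⟩
    exact (le_sum (fun i => #(A i)) i).trans (le_max_right _ _)
  let Bad (ν : Cardinal.{u}) : Type u :=
    {W : Submodule R (ν.out →₀ R) // ModuleCat.of R (FreeQuotient ν W) ∉ leftPerp ℬ}
  have hdet : ∀ ν (W : Bad ν), ∃ B ∈ ℬ, ¬ Orth R (FreeQuotient ν W.1) B := by
    intro ν W
    by_contra! hc
    exact W.2 (mem_leftPerp_iff.2 hc)
  choose B hBℬ hBW using hdet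
  let k : ℕ → Cardinal.{u} := fun n => n.rec μ fun _ ν =>
    Order.succ (max ν (max #(Bad ν) (Cardinal.sum fun W : Bad ν => #(B ν W))))
  have hk : ∀ n, max (k n) (max #(Bad (k n)) (Cardinal.sum fun W => #(B (k n) W))) < k (n + 1) :=
    fun n => Order.lt_succ _
  have hkk : ∀ n, k n < k (n + 1) := fun n => (le_max_left _ _).trans_lt (hk n)
  let κ := ⨆ n, k n
  have hkκ : ∀ n, k n ≤ κ := fun n => le_ciSup (bddAbove_of_small (s := range k)) n
  have hμκ : μ ≤ κ := hkκ 0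
  have hsing : κ.IsSingular := isSingular_iSup_nat hμ hkk
  let T : (Σ n, Bad (k n)) → ModuleCat.{u} R := fun W => B _ W.2
  have hTℬ : range T ⊆ ℬ := by
    rintro _ ⟨W, rfl⟩
    exact hBℬ _ _
  have hι : #(Σ n, Bad (k n)) ≤ κ := by
    rw [mk_sigma]
    refine (sum_le_lift_mk_mul_iSup _).trans ?_
    rw [mk_nat, lift_aleph0]
    refine mul_le_of_le (hμ.trans hμκ) (hμ.trans hμκ) (ciSup_le' fun n => ?_)
    exact (((le_max_left _ _).trans (le_max_right _ _)).trans (hk n).le).trans (hkκ (n + 1))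
  have hTκ : ∀ W, #(T W) ≤ κ := fun W =>
    ((((le_sum (fun V => #(B _ V)) W.2).trans (le_max_right _ _)).trans (le_max_right _ _)).trans
      (hk W.1).le).trans (hkκ (W.1 + 1))
  have hlt : ∀ (X : Type u) [AddCommGroup X] [Module R X],
      ModuleCat.of R X ∈ leftPerp (range T) → #X < κ → ModuleCat.of R X ∈ leftPerp ℬ := by
    intro X _ _ hX hXκ
    obtain ⟨n, hn⟩ := exists_lt_of_lt_ciSup hXκ
    obtain ⟨W, ⟨e⟩⟩ := exists_freeQuotient_equiv (R := R) hn.le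
    refine mem_leftPerp_congr e ?_
    by_contra hW
    exact hBW _ ⟨W, hW⟩ (mem_leftPerp_iff.1 (mem_leftPerp_congr e.symm hX) _
      ⟨⟨n, ⟨W, hW⟩⟩, rfl⟩)
  refine ⟨range T, small_range _, hC.left_eq.trans ((leftPerp_anti hTℬ).antisymm ?_)⟩
  refine leftPerp_range_subset hΦ hμ hR hμκ hι hTκ (hTℬ.trans hB) hTℬ hHill fun X _ _ hX hXκ => ?_
  rcases hXκ.lt_or_eq with h | h
  · exact hlt X hX h
  · refine mem_leftPerp_of_isSingular hμ hR (isSubmoduleClosed_leftPerp (hTℬ.trans hB))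
      (leftPerp_anti hTℬ) hHill hX (h ▸ hsing) (h ▸ (hkk 0).trans_le (hkκ 1)) fun Y _ _ hY hYX =>
        hlt Y hY (hYX.trans_eq h)

end Generation

theorem proposition2p11 (hΦ : WeakDiamond.{u}) (R : Type u) [Ring R]
    (𝒜 ℬ : Set (ModuleCat.{u} Rᵐᵒᵖ)) (hC : IsCotorsionPair 𝒜 ℬ) (hB : ℬ ⊆ injDimLE Rᵐᵒᵖ 1) :
    IsGeneratedBySet 𝒜 ℬ ↔ IsCogeneratedBySet 𝒜 ℬ :=
  ⟨isCogeneratedBySet_of_isGeneratedBySet hΦ hC hB, isGeneratedBySet_of_isCogeneratedBySet hΦ hC hB⟩
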